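/- Let $d\in\mathbb{N}$ and $\alpha=(\alpha_1,\dots,\alpha_d)\in(0,\infty)^d$. For $a,c>0$ let $\Gamma_{a,c}$ be the gamma distribution with shape $a$ and scale $c$, i.e. with density $x^{a-1}e^{-x/c}/(c^a\Gamma(a))$ on $(0,\infty)$, and put $\Gamma_{\alpha,1}=\Gamma_{\alpha_1,1}\times\cdots\times\Gamma_{\alpha_d,1}$. With $(a)_n=a(a+1)\cdots(a+n-1)$ let $$\tilde L_{n,a}(x)=(-1)^n (a)_n\sum_{k=0}^n\frac{(-n)_k}{(a)_k}\frac{x^k}{k!}$$ be the Laguerre polynomial with leading coefficient one, and for $\mathbf n\in\mathbb{Z}_+^d$ let $$Q_{\mathbf n}(x)=\prod_{i=1}^d\frac{\tilde L_{n_i,\alpha_i}(x_i)}{\sqrt{n_i!\,(\alpha_i)_{n_i}}},$$ the orthonormal polynomials of $\Gamma_{\alpha,1}$. Let $(X,Y)$ be a pair of random vectors in $\mathbb{R}_+^d$, each with distribution $\Gamma_{\alpha,1}$. Say that $(X,Y)$ has canonical correlations, with canonical correlation sequence $(\rho_{\mathbf n})_{\mathbf n\in\mathbb{Z}_+^d}$,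 if $\mathbb{E}[Q_{\mathbf n}(X)Q_{\mathbf m}(Y)]=\rho_{\mathbf n}\delta_{\mathbf n,\mathbf m}$ for all $\mathbf n,\mathbf m\in\mathbb{Z}_+^d$. For a probability measure $P^*$ on $[0,\infty]^d$, the algorithm with input $(\alpha,P^*)$ is as follows: draw $B=b$ from $P^*$; given $b$, independently for $j=1,\dots,d$, draw $X_j=x_j$ from $\Gamma_{\alpha_j,1}$, then $N_j=n_j$ from the Poisson distribution with mean $b_jx_j$, then $Y_j$ from $\Gamma_{\alpha_j+n_j,(1+b_j)^{-1}}$, where for $b_j=\infty$ one puts $Y_j=X_j$; return $X=(X_j)_j$ and $Y=(Y_j)_j$. Say that $(X,Y)$ is generated by the algorithm with $P^*$ if its joint law is the law of this output. Put $Z_i=B_i/(1+B_i)\in[0,1]$, with $Z_i=1$ if $B_i=\infty$. Then: (i) $(X,Y)$ has canonical correlations if and only if it is generated by the algorithm for some probability measure $P^*$ on $[0,\infty]^d$. (ii) If $(X,Y)$ is generated by the algorithm with $P^*$, then a family $(\rho_{\mathbf n})$ is its canonical correlation sequence if and only if $\rho_{\mathbf n}=\mathbb{E}\big[\prod_{i=1}^dZ_i^{n_i}\big]$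 for every $\mathbf n\in\mathbb{Z}_+^d$, where $B$ has distribution $P^*$. (iii) $(X,Y)$ is generated by the algorithm for some $P^*$ concentrated on $[0,\infty)^d$ if and only if it has canonical correlations and $\mathbb{P}(X_i=Y_i)=0$ for $i=1,\dots,d$. -/

import Mathlib

open MeasureTheory ProbabilityTheory
open scoped ENNReal NNReal

namespace GammaCC

/-- The Laguerre polynomial `L_{n,a}(x) = (a)_n / n! * ₁F₁(-n; a; x)`; the hypergeometric series
terminates, because `(-n)_k = 0` for `k > n`. -/
noncomputable def laguerre (n : ℕ) (a x : ℝ) : ℝ :=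
  (ascPochhammer ℝ n).eval a / (n.factorial : ℝ) *
    ∑ k ∈ Finset.range (n + 1),
      (ascPochhammer ℝ k).eval (-(n : ℝ)) / (ascPochhammer ℝ k).eval a *
        (x ^ k / (k.factorial : ℝ))

/-- The Laguerre polynomial with leading coefficient one. -/
noncomputable def monicLaguerre (n : ℕ) (a x : ℝ) : ℝ :=
  (n.factorial : ℝ) * (-1) ^ n * laguerre n a x

/-- The constant of orthogonality `n! (a)_n` of the monic Laguerre polynomial. -/
noncomputable def laguerreNormSq (n : ℕ) (a : ℝ) : ℝ :=
  (n.factorial : ℝ) * (ascPochhammer ℝ n).eval a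

/-- The orthonormal product Laguerre polynomial of multi-index `n`. -/
noncomputable def productLaguerre {d : ℕ} (α : Fin d → ℝ) (n : Fin d → ℕ) (x : Fin d → ℝ) : ℝ :=
  ∏ i, monicLaguerre (n i) (α i) (x i) / Real.sqrt (laguerreNormSq (n i) (α i))

/-- The product gamma distribution on `ℝ^d` with shape parameters `α i` and unit scale. -/
noncomputable def productGamma {d : ℕ} (α : Fin d → ℝ) : Measure (Fin d → ℝ) :=
  Measure.pi fun i => gammaMeasure (α i) 1

/-- `ρ` is the canonical correlation sequence of `(X, Y)` with respect to the orthonormal product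
Laguerre polynomials. (When `X` and `Y` both have law `productGamma α`, the integrand is a product
of two square-integrable functions, hence integrable.) -/
def IsCanonicalCorrelationSequence {d : ℕ} {Ω : Type*} [MeasurableSpace Ω] (P : Measure Ω)
    (α : Fin d → ℝ) (X Y : Ω → Fin d → ℝ) (ρ : (Fin d → ℕ) → ℝ) : Prop :=
  ∀ n m : Fin d → ℕ,
    ∫ ω, productLaguerre α n (X ω) * productLaguerre α m (Y ω) ∂P = if n = m then ρ n else 0

/-- `(X, Y)` has canonical correlations. -/
def HasCanonicalCorrelations {d : ℕ} {Ω : Type*} [MeasurableSpace Ω] (P : Measure Ω)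
    (α : Fin d → ℝ) (X Y : Ω → Fin d → ℝ) : Prop :=
  ∃ ρ : (Fin d → ℕ) → ℝ, IsCanonicalCorrelationSequence P α X Y ρ

/-- The law of the second coordinate given `X = x`, for finite `b`: draw `n` from the Poisson
distribution with mean `b * x`, then draw from the gamma distribution with shape `a + n` and scale
`(1 + b)⁻¹`, that is, with rate `1 + b`. -/
noncomputable def poissonGamma (a : ℝ) (b : ℝ≥0) (x : ℝ) : Measure ℝ :=
  (poissonMeasure (b * x.toNNReal)).bind fun n : ℕ => gammaMeasure (a + n) (1 + b)

/-- The law of the output `(X, Y)` of the one-dimensional algorithm started from `(a, b)`: draw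
`X = x` from the gamma distribution with shape `a` and unit scale, then draw `Y` from
`poissonGamma a b x`; for `b = ∞` put `Y = X`. -/
noncomputable def oneDimAlgorithm (a : ℝ) (b : ℝ≥0∞) : Measure (ℝ × ℝ) :=
  if b = ⊤ then (gammaMeasure a 1).map fun x => (x, x)
  else (gammaMeasure a 1).bind fun x => (poissonGamma a b.toNNReal x).map (Prod.mk x)

/-- The law of the output `(X, Y)` of the `d`-dimensional algorithm: draw `B = b` from `Pstar`;
given `b`, make `d` independent runs of the one-dimensional algorithm, the `j`-th one started from
`(α j, b j)`; return the two vectors. -/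
noncomputable def mixtureAlgorithm {d : ℕ} (α : Fin d → ℝ) (Pstar : Measure (Fin d → ℝ≥0∞)) :
    Measure ((Fin d → ℝ) × (Fin d → ℝ)) :=
  (Pstar.bind fun b => Measure.pi fun j => oneDimAlgorithm (α j) (b j)).map
    fun v => (fun j => (v j).1, fun j => (v j).2)

/-- `(X, Y)` has the law of the output of the `d`-dimensional algorithm run with `Pstar`. -/
def GeneratedBy {d : ℕ} {Ω : Type*} [MeasurableSpace Ω] (P : Measure Ω)
    (α : Fin d → ℝ) (X Y : Ω → Fin d → ℝ) (Pstar : Measure (Fin d → ℝ≥0∞)) : Prop :=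
  HasLaw (fun ω => (X ω, Y ω)) (mixtureAlgorithm α Pstar) P

/-- `b / (1 + b)`, with value one at `b = ∞`. -/
noncomputable def ratio (b : ℝ≥0∞) : ℝ :=
  if b = ⊤ then 1 else b.toReal / (1 + b.toReal)

/-! The conditional laws used above depend measurably on the conditioning variables, so that the
mixtures are genuine probability measures. -/

theorem measurable_gammaMeasure_rate (a : ℝ) : Measurable fun r : ℝ => gammaMeasure a r := by
  refine Measure.measurable_of_measurable_coe _ fun s hs => ?_
  have h : Measurable fun p : ℝ × ℝ => gammaPDF a p.1 p.2 := by
    unfold gammaPDF gammaPDFReal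
    refine Measurable.ennreal_ofReal (Measurable.ite ?_ ?_ measurable_const)
    · exact measurableSet_Ici.preimage measurable_snd
    · fun_prop
  simp_rw [gammaMeasure, withDensity_apply _ hs]
  exact h.lintegral_prod_right'

theorem measurable_poissonMeasure : Measurable fun r : ℝ≥0 => poissonMeasure r := by
  refine Measure.measurable_of_measurable_coe _ fun s hs => ?_
  simp_rw [poissonMeasure, Measure.sum_apply _ hs, Measure.smul_apply]
  refine Measurable.tsum fun n => ?_
  exact Measurable.mul_const (by fun_prop) _

theorem poissonGamma_apply (a : ℝ) (b : ℝ≥0) (x : ℝ) {s : Set ℝ} (hs : MeasurableSet s) :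
    poissonGamma a b x s =
      ∑' n : ℕ, gammaMeasure (a + n) (1 + b) s * poissonMeasure (b * x.toNNReal) {n} := by
  rw [poissonGamma, Measure.bind_apply hs (measurable_of_countable _).aemeasurable,
    lintegral_countable']

theorem measurable_poissonGamma (a : ℝ) :
    Measurable fun p : ℝ≥0 × ℝ => poissonGamma a p.1 p.2 := by
  refine Measure.measurable_of_measurable_coe _ fun s hs => ?_
  simp_rw [poissonGamma_apply _ _ _ hs]
  refine Measurable.tsum fun n => Measurable.mul ?_ ?_
  · exact (Measure.measurable_coe hs).comp
      ((measurable_gammaMeasure_rate (a + n)).comp (by fun_prop))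
  · exact (Measure.measurable_coe (measurableSet_singleton n)).comp
      (measurable_poissonMeasure.comp (by fun_prop))

theorem isProbabilityMeasure_poissonGamma {a : ℝ} (ha : 0 < a) (b : ℝ≥0) (x : ℝ) :
    IsProbabilityMeasure (poissonGamma a b x) := by
  unfold poissonGamma
  refine isProbabilityMeasure_bind (measurable_of_countable _).aemeasurable
    (Filter.Eventually.of_forall fun n => ?_)
  exact isProbabilityMeasure_gammaMeasure (by positivity) (by positivity)

theorem measurable_map_poissonGamma {a : ℝ} (ha : 0 < a) :
    Measurable fun p : ℝ≥0 × ℝ => (poissonGamma a p.1 p.2).map (Prod.mk p.2) := by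
  refine Measure.measurable_of_measurable_coe _ fun s hs => ?_
  let κ : Kernel (ℝ≥0 × ℝ) ℝ := ⟨_, measurable_poissonGamma a⟩
  have : IsMarkovKernel κ := ⟨fun p => isProbabilityMeasure_poissonGamma ha p.1 p.2⟩
  have ht : MeasurableSet {q : (ℝ≥0 × ℝ) × ℝ | (q.1.2, q.2) ∈ s} :=
    hs.preimage (by fun_prop)
  have h := Kernel.measurable_kernel_prodMk_left (κ := κ) ht
  simp_rw [Measure.map_apply measurable_prodMk_left hs]
  exact h

theorem isProbabilityMeasure_oneDimAlgorithm {a : ℝ} (ha : 0 < a) (b : ℝ≥0∞) :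
    IsProbabilityMeasure (oneDimAlgorithm a b) := by
  have := isProbabilityMeasure_gammaMeasure ha one_pos
  unfold oneDimAlgorithm
  split_ifs
  · exact Measure.isProbabilityMeasure_map (by fun_prop)
  · refine isProbabilityMeasure_bind
      ((measurable_map_poissonGamma ha).comp measurable_prodMk_left).aemeasurable
      (Filter.Eventually.of_forall fun x => ?_)
    have := isProbabilityMeasure_poissonGamma ha b.toNNReal x
    exact Measure.isProbabilityMeasure_map measurable_prodMk_left.aemeasurable

theorem measurable_oneDimAlgorithm {a : ℝ} (ha : 0 < a) : Measurable (oneDimAlgorithm a) := by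
  have := isProbabilityMeasure_gammaMeasure ha one_pos
  unfold oneDimAlgorithm
  refine Measurable.ite (measurableSet_singleton _) measurable_const ?_
  refine Measure.measurable_of_measurable_coe _ fun s hs => ?_
  have h (b : ℝ≥0) : AEMeasurable (fun x => (poissonGamma a b x).map (Prod.mk x))
      (gammaMeasure a 1) :=
    ((measurable_map_poissonGamma ha).comp measurable_prodMk_left).aemeasurable
  simp_rw [Measure.bind_apply hs (h _)]
  have h2 : Measurable fun p : ℝ≥0 × ℝ => (poissonGamma a p.1 p.2).map (Prod.mk p.2) s :=
    (Measure.measurable_coe hs).comp (measurable_map_poissonGamma ha)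
  exact (h2.lintegral_prod_right' (ν := gammaMeasure a 1)).comp ENNReal.measurable_toNNReal

theorem measurable_pi_oneDimAlgorithm {d : ℕ} {α : Fin d → ℝ} (hα : ∀ i, 0 < α i) :
    Measurable fun b : Fin d → ℝ≥0∞ => Measure.pi fun j => oneDimAlgorithm (α j) (b j) := by
  have (b : Fin d → ℝ≥0∞) (j : Fin d) : IsProbabilityMeasure (oneDimAlgorithm (α j) (b j)) :=
    isProbabilityMeasure_oneDimAlgorithm (hα j) (b j)
  refine Measurable.measure_of_isPiSystem_of_isProbabilityMeasure generateFrom_pi.symm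
    isPiSystem_pi ?_
  rintro _ ⟨t, ht, rfl⟩
  simp_rw [Measure.pi_pi]
  refine Finset.measurable_prod _ fun j _ => ?_
  have htj : MeasurableSet (t j) := ht j (Set.mem_univ j)
  exact (Measure.measurable_coe htj).comp
    ((measurable_oneDimAlgorithm (hα j)).comp (measurable_pi_apply j))

theorem isProbabilityMeasure_mixtureAlgorithm {d : ℕ} {α : Fin d → ℝ} (hα : ∀ i, 0 < α i)
    (Pstar : Measure (Fin d → ℝ≥0∞)) [IsProbabilityMeasure Pstar] :
    IsProbabilityMeasure (mixtureAlgorithm α Pstar) := by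
  have (b : Fin d → ℝ≥0∞) (j : Fin d) : IsProbabilityMeasure (oneDimAlgorithm (α j) (b j)) :=
    isProbabilityMeasure_oneDimAlgorithm (hα j) (b j)
  have : IsProbabilityMeasure
      (Pstar.bind fun b => Measure.pi fun j => oneDimAlgorithm (α j) (b j)) :=
    isProbabilityMeasure_bind (measurable_pi_oneDimAlgorithm hα).aemeasurable
      (Filter.Eventually.of_forall fun b => inferInstance)
  exact Measure.isProbabilityMeasure_map (by fun_prop)

end GammaCC

/-! For a single run with `z = b / (1 + b)`, the moments satisfy `E[X^j Y^k] / ((a)_j (a)_k) = ∑ m,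
C(j,m) C(k,m) z^m m! / (a)_m`. This is a factorization of the moment matrix: binomial matrix,
diagonal matrix, transposed binomial matrix. Up to normalization, the Laguerre polynomials are the
signed binomial combinations of `x^k / (a)_k`, hence apply the inverse of the binomial matrix on
both sides, and only the diagonal `z^n n! / (a)_n` remains. Independence of the coordinates given
`B` and integration over `B` yield the correlations `E[∏ Z_i^{n_i}]`
(`hasCorrelations_mixtureAlgorithm`).

Conversely, a canonical correlation sequence `ρ` determines all mixed moments
(`HasCorrelations.integral_pow`). Under the law weighted by `∏ X_i^K`, the moment of `∏ (Y_i /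
X_i)^{n_i}` is a combination of the `ρ_m` with `m ≤ n`, and as `K → ∞` only `ρ_n` survives. The
ratios are clamped to the unit cube, where compactness supplies a limit law. Clamping loses nothing
in the limit, because all limiting moments are at most one by `HasCorrelations.le_one`. So `ρ` is a
moment sequence on the cube (`HasCorrelations.exists_unitInterval_moments`), and the corresponding
algorithm has the same correlations as the given pair.

The two laws then coincide: gamma marginals have exponential moments, so mixed moments determine the
joint law (`HasCorrelations.measure_eq`). Part (iii) follows from `P(X_i = Y_i) = P*(B_i = ∞)`: for
finite `b` the pair is a mixture of products of atomless laws. -/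

namespace GammaCC

/-! ### Rising factorials and binomial identities -/

/-- The rising factorial `(a)_n`. -/
noncomputable abbrev rising (a : ℝ) (n : ℕ) : ℝ := (ascPochhammer ℝ n).eval a

theorem rising_pos {a : ℝ} (ha : 0 < a) (n : ℕ) : 0 < rising a n := ascPochhammer_pos n a ha

theorem rising_zero (a : ℝ) : rising a 0 = 1 := by simp [rising]

theorem rising_succ (a : ℝ) (n : ℕ) : rising a (n + 1) = rising a n * (a + n) :=
  ascPochhammer_succ_eval n a

theorem rising_add (a : ℝ) (m n : ℕ) : rising a (m + n) = rising a m * rising (a + m) n := by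
  induction n with
  | zero => simp [rising_zero]
  | succ n ih => rw [← add_assoc, rising_succ, ih, rising_succ]; push_cast; ring

theorem rising_succ' (a : ℝ) (n : ℕ) : rising a (n + 1) = a * rising (a + 1) n := by
  rw [add_comm, rising_add]
  simp [rising]

theorem Gamma_add_nat {a : ℝ} (ha : 0 < a) (n : ℕ) :
    Real.Gamma (a + n) = rising a n * Real.Gamma a := by
  induction n with
  | zero => simp [rising_zero]
  | succ n ih =>
    rw [Nat.cast_succ, ← add_assoc, Real.Gamma_add_one (by positivity), ih, rising_succ]; ring

/-- The common factor is `(x + 1)_l`, and `x + 1 + l = x + (l + 1)`. This difference rule drives the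
induction in `rising_add_nat`. -/
theorem rising_one_add_succ (x : ℝ) (l : ℕ) :
    rising (x + 1) (l + 1) = rising x (l + 1) + (l + 1) * rising (x + 1) l := by
  rw [rising_succ, rising_succ']; ring

/-- A form of the Chu–Vandermonde identity. -/
theorem rising_add_nat (a : ℝ) (n l N : ℕ) (hl : l ≤ N) :
    rising (a + n) l = ∑ i ∈ Finset.range (N + 1),
      (l.choose i : ℝ) * (n.descFactorial i : ℝ) * rising (a + i) (l - i) := by
  induction n generalizing a l N with
  | zero =>
    rw [Finset.sum_eq_single 0]
    · simp
    · intro i _ hi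
      obtain ⟨i, rfl⟩ := Nat.exists_eq_succ_of_ne_zero hi
      simp
    · simp
  | succ n ih =>
    cases l with
    | zero =>
      rw [Finset.sum_eq_single 0]
      · simp [rising_zero]
      · intro i _ hi
        obtain ⟨i, rfl⟩ := Nat.exists_eq_succ_of_ne_zero hi
        simp
      · simp
    | succ l =>
      obtain ⟨N, rfl⟩ : ∃ M, N = M + 1 := ⟨N - 1, by omega⟩
      -- The difference rule splits `(a + n + 1)_{l+1}` into the cases `(a, l + 1)` and `(a + 1, l)`
      -- for `n`. The bound `N` may exceed `l` since the extra binomial coefficients vanish.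
      have h1 := ih a (l + 1) (N + 1) hl
      have h2 := ih (a + 1) l N (by omega)
      rw [Nat.cast_succ, ← add_assoc, rising_one_add_succ, h1,
        show a + n + 1 = a + 1 + n by ring, h2, Finset.sum_range_succ',
        Finset.sum_range_succ' _ (N + 1),
        Finset.mul_sum]
      simp only [Nat.choose_zero_right, Nat.descFactorial_zero, Nat.cast_one]
      rw [add_right_comm, ← Finset.sum_add_distrib, Nat.cast_zero]
      congr 1
      refine Finset.sum_congr rfl fun i _ => ?_
      have e1 : ((n + 1).descFactorial (i + 1) : ℝ) =
          n.descFactorial (i + 1) + (i + 1) * n.descFactorial i := by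
        rw [Nat.succ_descFactorial_succ, Nat.descFactorial_succ]
        rcases le_or_gt i n with h | h
        · push_cast [Nat.cast_sub h]; ring
        · rw [Nat.descFactorial_of_lt h]; simp
      have e2 : ((l + 1).choose (i + 1) : ℝ) * (i + 1) = (l + 1) * l.choose i := by
        exact_mod_cast (Nat.add_one_mul_choose_eq l i).symm
      rw [e1, Nat.add_sub_add_right, show a + 1 + i = a + ((i + 1 : ℕ) : ℝ) by push_cast; ring]
      linear_combination (-(n.descFactorial i : ℝ) * rising (a + ((i + 1 : ℕ) : ℝ)) (l - i)) * e2

/-- Binomial inversion: the matrix of binomial coefficients and its signed version are inverse to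
each other. -/
theorem sum_choose_mul_choose (n i : ℕ) :
    ∑ k ∈ Finset.range (n + 1), ((n.choose k : ℝ) * (-1) ^ (n - k)) * (k.choose i : ℝ) =
      if n = i then 1 else 0 := by
  -- Coefficient of `X^i` in `X^n = ((X + 1) - 1)^n`.
  have h := congrArg (fun p : Polynomial ℝ => p.coeff i)
    (add_pow (Polynomial.X + 1 : Polynomial ℝ) (-1) n)
  have e (k : ℕ) : ((Polynomial.X + 1 : Polynomial ℝ) ^ k * (-1) ^ (n - k) * (n.choose k : Polynomial ℝ)) =
      Polynomial.C ((n.choose k : ℝ) * (-1) ^ (n - k)) * (Polynomial.X + 1) ^ k := by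
    simp; ring
  simp only [add_neg_cancel_right, Polynomial.finsetSum_coeff, e, Polynomial.coeff_C_mul,
    Polynomial.coeff_X_add_one_pow, Polynomial.coeff_X_pow] at h
  rw [← h]
  simp [eq_comm]

/-- Coefficient of `X^m` in `(z(X + 1) + (1 - z))^k = (1 + zX)^k`; equivalently, the factorial
moments of a binomial law. -/
theorem sum_binomial_mul_choose (z : ℝ) (k m : ℕ) :
    ∑ i ∈ Finset.range (k + 1), (k.choose i : ℝ) * z ^ i * (1 - z) ^ (k - i) * (i.choose m : ℝ) =
      (k.choose m : ℝ) * z ^ m := by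
  have h := congrArg (fun p : Polynomial ℝ => p.coeff m)
    (add_pow (Polynomial.C z * (Polynomial.X + 1) : Polynomial ℝ) (Polynomial.C (1 - z)) k)
  have e (i : ℕ) : (Polynomial.C z * (Polynomial.X + 1 : Polynomial ℝ)) ^ i *
      Polynomial.C (1 - z) ^ (k - i) * (k.choose i : Polynomial ℝ) =
      Polynomial.C ((k.choose i : ℝ) * z ^ i * (1 - z) ^ (k - i)) * (Polynomial.X + 1) ^ i := by
    simp [mul_pow]; ring
  have e' : (Polynomial.C z * (Polynomial.X + 1) : Polynomial ℝ) + Polynomial.C (1 - z) =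
      (Polynomial.X + 1).comp (Polynomial.C z * Polynomial.X) := by
    simp; ring
  simp only [e, e', Polynomial.finsetSum_coeff, Polynomial.coeff_C_mul,
    Polynomial.coeff_X_add_one_pow, ← Polynomial.pow_comp, Polynomial.comp_C_mul_X_coeff] at h
  rw [← h]

/-- The kernel of mixed gamma moments, diagonalized by binomial coefficients. -/
theorem rising_add_div {a : ℝ} (ha : 0 < a) (j i : ℕ) :
    rising a (j + i) / (rising a j * rising a i) =
      ∑ m ∈ Finset.range (i + 1),
        (j.choose m : ℝ) * (i.choose m : ℝ) * ((m.factorial : ℝ) / rising a m) := by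
  have hj := (rising_pos ha j).ne'
  have hi := (rising_pos ha i).ne'
  rw [rising_add, mul_div_mul_left _ _ hj, rising_add_nat a j i i le_rfl, Finset.sum_div]
  refine Finset.sum_congr rfl fun m hm => ?_
  have hm' : m ≤ i := by simpa [Nat.lt_succ_iff] using hm
  have hmm := (rising_pos ha m).ne'
  have : rising a i = rising a m * rising (a + m) (i - m) := by
    rw [← rising_add]; congr; omega
  have h2 : rising (a + m) (i - m) ≠ 0 := fun h => hi (by rw [this, h, mul_zero])
  rw [this, Nat.descFactorial_eq_factorial_mul_choose]
  push_cast
  field_simp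

/-- The mixed moments of the correlated pair in terms of the correlation `z`. -/
theorem sum_binomial_mul_rising {a : ℝ} (ha : 0 < a) (z : ℝ) (j k : ℕ) :
    ∑ i ∈ Finset.range (k + 1), (k.choose i : ℝ) * z ^ i * (1 - z) ^ (k - i) *
        (rising a (j + i) / (rising a j * rising a i)) =
      ∑ m ∈ Finset.range (k + 1),
        (j.choose m : ℝ) * (k.choose m : ℝ) * (z ^ m * ((m.factorial : ℝ) / rising a m)) := by
  have h (i : ℕ) (hi : i ∈ Finset.range (k + 1)) :
      rising a (j + i) / (rising a j * rising a i) = ∑ m ∈ Finset.range (k + 1),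
        (j.choose m : ℝ) * (i.choose m : ℝ) * ((m.factorial : ℝ) / rising a m) := by
    rw [rising_add_div ha]
    refine Finset.sum_subset ?_ fun m _ hm => ?_
    · rw [Finset.range_subset_range]; simp at hi; omega
    · rw [Nat.choose_eq_zero_of_lt (n := i)]
      · simp
      · simp at hm; omega
  rw [Finset.sum_congr rfl fun i hi => by rw [h i hi, Finset.mul_sum], Finset.sum_comm]
  refine Finset.sum_congr rfl fun m _ => ?_
  have := sum_binomial_mul_choose z k m
  calc _ = (∑ i ∈ Finset.range (k + 1), (k.choose i : ℝ) * z ^ i * (1 - z) ^ (k - i) *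
        (i.choose m : ℝ)) * ((j.choose m : ℝ) * ((m.factorial : ℝ) / rising a m)) := by
        rw [Finset.sum_mul]; exact Finset.sum_congr rfl fun i _ => by ring
    _ = _ := by rw [this]; ring

/-! ### Moments of the gamma law and of the one-dimensional algorithm -/

theorem ae_pos_gammaMeasure (a r : ℝ) : ∀ᵐ x ∂gammaMeasure a r, 0 < x := by
  have h : gammaMeasure a r (Set.Iic 0) = 0 := by
    rw [gammaMeasure, withDensity_apply _ measurableSet_Iic]
    have : volume.restrict (Set.Iic (0 : ℝ)) = volume.restrict (Set.Iio (0 : ℝ)) :=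
      Measure.restrict_congr_set Iio_ae_eq_Iic.symm
    rw [this, lintegral_gammaPDF_of_nonpos le_rfl]
  rw [ae_iff]
  convert! h using 2
  ext x; simp

instance nullSingletonClass_gammaMeasure (a r : ℝ) : NullSingletonClass (gammaMeasure a r) where
  measure_singleton x := by
    rw [gammaMeasure, withDensity_apply _ (measurableSet_singleton x),
      Measure.restrict_singleton]
    simp

/-- Weighting a gamma law by a power and an exponential gives a multiple of a gamma law. -/
theorem lintegral_gammaMeasure_tilt {a r b : ℝ} (ha : 0 < a) (hr : 0 < r) (hb : 0 < r + b) (k : ℕ)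
    {f : ℝ → ℝ≥0∞} (hf : Measurable f) :
    ∫⁻ x, ENNReal.ofReal (x ^ k * Real.exp (-(b * x))) * f x ∂gammaMeasure a r =
      ENNReal.ofReal (rising a k * r ^ a / (r + b) ^ (a + k)) *
        ∫⁻ x, f x ∂gammaMeasure (a + k) (r + b) := by
  have hG := Real.Gamma_pos_of_pos ha
  have hm (a r : ℝ) : Measurable (gammaPDF a r) := (measurable_gammaPDFReal a r).ennreal_ofReal
  have hR := rising_pos ha k
  rw [gammaMeasure, gammaMeasure, lintegral_withDensity_eq_lintegral_mul _ (hm a r) (by fun_prop),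
    lintegral_withDensity_eq_lintegral_mul _ (hm _ _) (by fun_prop),
    ← lintegral_const_mul _ (by fun_prop)]
  refine lintegral_congr_ae ?_
  -- The origin is discarded because splitting the real power of `x` needs `x > 0`; for `x < 0` both
  -- densities vanish.
  filter_upwards [Measure.ae_ne volume (0 : ℝ)] with x hx
  simp only [Pi.mul_apply]
  rw [← mul_assoc, ← mul_assoc]
  congr 1
  rcases lt_or_gt_of_ne hx with hx | hx
  · simp [gammaPDF_of_neg hx]
  rw [gammaPDF_of_nonneg hx.le, gammaPDF_of_nonneg hx.le, ← ENNReal.ofReal_mul (by positivity),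
    ← ENNReal.ofReal_mul (by positivity)]
  congr 1
  have e1 : x ^ (a + k - 1) = x ^ (a - 1) * x ^ k := by
    rw [← Real.rpow_natCast, ← Real.rpow_add hx]; congr 1; ring
  have e2 : Real.exp (-((r + b) * x)) = Real.exp (-(r * x)) * Real.exp (-(b * x)) := by
    rw [← Real.exp_add]; congr 1; ring
  rw [e1, e2, Gamma_add_nat ha]
  field_simp

theorem integrable_and_integral_eq_of_lintegral {Ω : Type*} [MeasurableSpace Ω] {μ : Measure Ω}
    {f : Ω → ℝ} {S : ℝ} (hf : AEStronglyMeasurable f μ) (h0 : 0 ≤ᵐ[μ] f) (hS : 0 ≤ S)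
    (h : ∫⁻ x, ENNReal.ofReal (f x) ∂μ = ENNReal.ofReal S) :
    Integrable f μ ∧ ∫ x, f x ∂μ = S := by
  refine ⟨(lintegral_ofReal_ne_top_iff_integrable hf h0).1 (by simp [h]), ?_⟩
  rw [integral_eq_lintegral_of_nonneg_ae h0 hf, h, ENNReal.toReal_ofReal hS]

theorem lintegral_pow_gammaMeasure {a r : ℝ} (ha : 0 < a) (hr : 0 < r) (k : ℕ) :
    ∫⁻ x, ENNReal.ofReal (x ^ k) ∂gammaMeasure a r = ENNReal.ofReal (rising a k / r ^ k) := by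
  have := isProbabilityMeasure_gammaMeasure (a := a + k) (r := r) (by positivity) hr
  have h := lintegral_gammaMeasure_tilt ha hr (b := 0) (by simpa) k (f := 1) measurable_one
  simp only [zero_mul, neg_zero, Real.exp_zero, mul_one, Pi.one_apply, add_zero, lintegral_one,
    measure_univ] at h
  rw [h, Real.rpow_add hr, Real.rpow_natCast, mul_comm (rising a k),
    mul_div_mul_left _ _ (Real.rpow_pos_of_pos hr a).ne']

theorem integrable_exp_gammaMeasure {a r c : ℝ} (ha : 0 < a) (hr : 0 < r) (hc : c < r) :
    Integrable (fun x => Real.exp (c * x)) (gammaMeasure a r) := by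
  have hrc : 0 < r + -c := by linarith
  have := isProbabilityMeasure_gammaMeasure (a := a + (0 : ℕ)) (r := r + -c) (by positivity) hrc
  have h := lintegral_gammaMeasure_tilt ha hr hrc 0 (f := 1) measurable_one
  refine (lintegral_ofReal_ne_top_iff_integrable (by fun_prop)
    (Filter.Eventually.of_forall fun x => (Real.exp_pos _).le)).1 ?_
  simp only [pow_zero, one_mul, Pi.one_apply, mul_one, lintegral_one, measure_univ, neg_mul,
    neg_neg] at h
  rw [h]
  exact ENNReal.ofReal_ne_top

theorem lintegral_poissonGamma (a : ℝ) (b : ℝ≥0) (x : ℝ) {f : ℝ → ℝ≥0∞} (hf : Measurable f) :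
    ∫⁻ y, f y ∂poissonGamma a b x = ∑' n : ℕ,
      poissonMeasure (b * x.toNNReal) {n} * ∫⁻ y, f y ∂gammaMeasure (a + n) (1 + b) := by
  rw [poissonGamma, Measure.lintegral_bind (measurable_of_countable _).aemeasurable
    hf.aemeasurable, lintegral_countable']
  simp_rw [mul_comm]

/-- The falling factorial kills the first `i` terms and cancels against `n!` in the others; shifting
the index by `i` leaves the exponential series. -/
theorem hasSum_descFactorial_poisson (r : ℝ) (i : ℕ) :
    HasSum (fun n : ℕ => Real.exp (-r) * r ^ n / n.factorial * (n.descFactorial i : ℝ)) (r ^ i) := by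
  rw [← hasSum_nat_add_iff' i, Finset.sum_eq_zero, sub_zero]
  · have h : HasSum (fun n : ℕ => r ^ n / (n.factorial : ℝ)) (Real.exp r) := by
      rw [Real.exp_eq_exp_ℝ]; exact NormedSpace.expSeries_div_hasSum_exp r
    have h2 := h.mul_left (Real.exp (-r) * r ^ i)
    rw [show Real.exp (-r) * r ^ i * Real.exp r = r ^ i by
      rw [mul_right_comm, ← Real.exp_add]; simp] at h2
    refine h2.congr_fun fun n => ?_
    have h3 : ((n + i).factorial : ℝ) = n.factorial * (n + i).descFactorial i := by
      rw [← Nat.factorial_mul_descFactorial (Nat.le_add_left i n)]; simp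
    have h4 : ((n + i).descFactorial i : ℝ) ≠ 0 := by
      rw [Nat.cast_ne_zero, Ne, Nat.descFactorial_eq_zero_iff_lt]; omega
    rw [h3, pow_add]
    field_simp
  · intro n hn
    rw [Nat.descFactorial_of_lt (by simpa using hn)]; simp

/-- Given `N = n` the moment is `(a + n)_k / (1 + b)^k`. Chu–Vandermonde expands it in falling
factorials of `n`, whose Poisson means are `(b x)^i`. With `z = b / (1 + b)` one has `b^i / (1 +
b)^k = z^i (1 - z)^(k - i)`. -/
theorem lintegral_pow_poissonGamma {a : ℝ} (ha : 0 < a) (b : ℝ≥0) {x : ℝ} (hx : 0 ≤ x) (k : ℕ) :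
    ∫⁻ y, ENNReal.ofReal (y ^ k) ∂poissonGamma a b x =
      ENNReal.ofReal (∑ i ∈ Finset.range (k + 1), (k.choose i : ℝ) * (b / (1 + b) : ℝ) ^ i *
        (1 - b / (1 + b) : ℝ) ^ (k - i) * (rising a k / rising a i) * x ^ i) := by
  rw [lintegral_poissonGamma _ _ _ (by fun_prop)]
  have hpos (n : ℕ) : 0 < a + n := by positivity
  have h1 (n : ℕ) : poissonMeasure (b * x.toNNReal) {n} *
      ∫⁻ y, ENNReal.ofReal (y ^ k) ∂gammaMeasure (a + n) (1 + b) =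
      ENNReal.ofReal (Real.exp (-(b * x)) * (b * x) ^ n / n.factorial *
        (rising (a + n) k / (1 + b) ^ k)) := by
    rw [lintegral_pow_gammaMeasure (hpos n) (by positivity), poissonMeasure_singleton,
      ENNReal.ofReal_mul (by positivity)]
    simp [hx]
  simp_rw [h1]
  have hs : HasSum (fun n : ℕ => Real.exp (-(b * x)) * (b * x) ^ n / n.factorial *
        (rising (a + n) k / (1 + b) ^ k)) (∑ i ∈ Finset.range (k + 1),
          (b * x) ^ i * ((k.choose i : ℝ) * rising (a + i) (k - i) / (1 + b) ^ k)) := by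
    have := hasSum_sum (s := Finset.range (k + 1)) (fun i _ =>
      (hasSum_descFactorial_poisson (b * x) i).mul_right
        ((k.choose i : ℝ) * rising (a + i) (k - i) / (1 + b : ℝ) ^ k))
    refine this.congr_fun fun n => ?_
    rw [rising_add_nat a n k k le_rfl, Finset.sum_div, Finset.mul_sum]
    exact Finset.sum_congr rfl fun i _ => by ring
  rw [← ENNReal.ofReal_tsum_of_nonneg _ hs.summable, hs.tsum_eq]
  · congr 1
    refine Finset.sum_congr rfl fun i hi => ?_
    have hik : i ≤ k := by simpa [Nat.lt_succ_iff] using hi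
    have h2 : rising a k = rising a i * rising (a + i) (k - i) := by
      rw [← rising_add]; congr; omega
    have h3 := (rising_pos ha i).ne'
    have h4 : (1 + b : ℝ) ≠ 0 := by positivity
    have h5 : (1 - b / (1 + b) : ℝ) = 1 / (1 + b) := by field_simp; ring
    have h6 : (1 + b : ℝ) ^ k = (1 + b) ^ i * (1 + b) ^ (k - i) := by
      rw [← pow_add]; congr; omega
    rw [h2, h5, h6, div_pow, div_pow, mul_pow]
    field_simp
    simp
  · intro n
    have := rising_pos (hpos n) k
    positivity

theorem lintegral_oneDimAlgorithm {a : ℝ} (ha : 0 < a) {b : ℝ≥0∞} (hb : b ≠ ⊤)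
    {f : ℝ × ℝ → ℝ≥0∞} (hf : Measurable f) :
    ∫⁻ p, f p ∂oneDimAlgorithm a b =
      ∫⁻ x, ∫⁻ y, f (x, y) ∂poissonGamma a b.toNNReal x ∂gammaMeasure a 1 := by
  have hm : AEMeasurable (fun x => (poissonGamma a b.toNNReal x).map (Prod.mk x))
      (gammaMeasure a 1) :=
    ((measurable_map_poissonGamma ha).comp measurable_prodMk_left).aemeasurable
  rw [oneDimAlgorithm, if_neg hb, Measure.lintegral_bind hm hf.aemeasurable]
  refine lintegral_congr fun x => ?_
  rw [lintegral_map hf measurable_prodMk_left]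

theorem ratio_nonneg (b : ℝ≥0∞) : 0 ≤ ratio b := by
  unfold ratio; split_ifs <;> positivity

theorem ratio_le_one (b : ℝ≥0∞) : ratio b ≤ 1 := by
  unfold ratio
  split_ifs
  · rfl
  · rw [div_le_one (by positivity)]; linarith

theorem ratio_coe (b : ℝ≥0) : ratio b = b / (1 + b) := by simp [ratio]

/-- For `b = ∞` this is the gamma moment of order `j + k`, expanded by `rising_add_div`. For finite
`b` the conditional moment of `Y` is a binomial average in `z`, which `sum_binomial_mul_rising`
evaluates. -/
theorem lintegral_pow_mul_pow_oneDimAlgorithm {a : ℝ} (ha : 0 < a) (b : ℝ≥0∞) (j k : ℕ) :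
    ∫⁻ p, ENNReal.ofReal (p.1 ^ j * p.2 ^ k) ∂oneDimAlgorithm a b =
      ENNReal.ofReal (rising a j * rising a k * ∑ m ∈ Finset.range (k + 1),
        (j.choose m : ℝ) * (k.choose m : ℝ) *
          (ratio b ^ m * ((m.factorial : ℝ) / rising a m))) := by
  by_cases hb : b = ⊤
  · subst hb
    rw [oneDimAlgorithm, if_pos rfl, lintegral_map (by fun_prop) (by fun_prop)]
    simp_rw [← pow_add]
    rw [lintegral_pow_gammaMeasure ha one_pos, one_pow, div_one]
    have h := rising_add_div ha j k
    have h1 := (rising_pos ha j).ne'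
    have h2 := (rising_pos ha k).ne'
    rw [div_eq_iff (by positivity)] at h
    rw [h, mul_comm]
    simp [ratio]
  · rw [lintegral_oneDimAlgorithm ha hb (by fun_prop), ← sum_binomial_mul_rising ha]
    lift b to ℝ≥0 using hb
    have hz0 := ratio_nonneg b
    have hz1 := sub_nonneg.2 (ratio_le_one b)
    have h1 : ∀ᵐ x ∂gammaMeasure a 1, ∫⁻ y, ENNReal.ofReal (x ^ j * y ^ k) ∂poissonGamma a b x =
        ∑ i ∈ Finset.range (k + 1), ENNReal.ofReal ((k.choose i : ℝ) * ratio b ^ i *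
          (1 - ratio b) ^ (k - i) * (rising a k / rising a i)) * ENNReal.ofReal (x ^ (j + i)) := by
      filter_upwards [ae_pos_gammaMeasure a 1] with x hx
      simp_rw [ENNReal.ofReal_mul (pow_nonneg hx.le j)]
      rw [lintegral_const_mul _ (by fun_prop), lintegral_pow_poissonGamma ha b hx.le, ← ratio_coe,
        ← ENNReal.ofReal_mul (by positivity), Finset.mul_sum, ENNReal.ofReal_sum_of_nonneg]
      · refine Finset.sum_congr rfl fun i _ => ?_
        have := rising_pos ha i
        have := rising_pos ha k
        rw [← ENNReal.ofReal_mul (by positivity)]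
        congr 1
        ring
      · intro i _
        have := rising_pos ha i
        have := rising_pos ha k
        positivity
    simp only [ENNReal.toNNReal_coe]
    rw [lintegral_congr_ae h1, lintegral_finsetSum _ (fun i _ => by fun_prop), Finset.mul_sum,
      ENNReal.ofReal_sum_of_nonneg]
    · refine Finset.sum_congr rfl fun i _ => ?_
      have h3 := rising_pos ha i
      have h4 := rising_pos ha k
      have h5 := rising_pos ha j
      rw [lintegral_const_mul _ (by fun_prop), lintegral_pow_gammaMeasure ha one_pos,
        ← ENNReal.ofReal_mul (by positivity)]
      congr 1
      field_simp
      simp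
    · intro i _
      have h3 := rising_pos ha i
      have h4 := rising_pos ha k
      have h5 := rising_pos ha j
      have h6 := rising_pos ha (j + i)
      positivity

/-! ### Symmetry, marginals and diagonal of the one-dimensional algorithm -/

/-- The Poisson weight is a multiple of `x^n e^{-bx}`, so it tilts the gamma law. The resulting law
of `X` given `N = n` is the one from which `Y` is drawn. -/
theorem poisson_smul_gammaMeasure {a : ℝ} (ha : 0 < a) (b : ℝ≥0) (n : ℕ) {f : ℝ → ℝ≥0∞}
    (hf : Measurable f) :
    ∫⁻ x, poissonMeasure (b * x.toNNReal) {n} * f x ∂gammaMeasure a 1 =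
      ENNReal.ofReal (b ^ n / n.factorial * (rising a n / (1 + b) ^ (a + n))) *
        ∫⁻ x, f x ∂gammaMeasure (a + n) (1 + b) := by
  have h := lintegral_gammaMeasure_tilt ha one_pos (b := b) (by positivity) n hf
  have hR := rising_pos ha n
  rw [Real.one_rpow, mul_one] at h
  rw [ENNReal.ofReal_mul (by positivity), mul_assoc, ← h, ← lintegral_const_mul _ (by fun_prop)]
  refine lintegral_congr_ae ?_
  filter_upwards [ae_pos_gammaMeasure a 1] with x hx
  rw [← mul_assoc, ← ENNReal.ofReal_mul (by positivity), poissonMeasure_singleton]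
  congr 2
  simp only [NNReal.coe_mul, Real.coe_toNNReal x hx.le]
  rw [mul_pow]
  ring

/-- For finite `b`, the law of the pair is a mixture of products of identical gamma laws. -/
theorem lintegral_oneDimAlgorithm_eq_tsum {a : ℝ} (ha : 0 < a) (b : ℝ≥0)
    {f : ℝ × ℝ → ℝ≥0∞} (hf : Measurable f) :
    ∫⁻ p, f p ∂oneDimAlgorithm a b =
      ∑' n : ℕ, ENNReal.ofReal (b ^ n / n.factorial * (rising a n / (1 + b) ^ (a + n))) *
        ∫⁻ x, ∫⁻ y, f (x, y) ∂gammaMeasure (a + n) (1 + b) ∂gammaMeasure (a + n) (1 + b) := by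
  have (n : ℕ) : IsProbabilityMeasure (gammaMeasure (a + n) (1 + b)) :=
    isProbabilityMeasure_gammaMeasure (by positivity) (by positivity)
  rw [lintegral_oneDimAlgorithm ha ENNReal.coe_ne_top hf]
  have h1 (x : ℝ) := lintegral_poissonGamma a b x (f := fun y => f (x, y)) (by fun_prop)
  simp only [ENNReal.toNNReal_coe, h1]
  have hm (n : ℕ) : Measurable fun x => ∫⁻ y, f (x, y) ∂gammaMeasure (a + n) (1 + b) :=
    hf.lintegral_prod_right'
  have hm2 (n : ℕ) : Measurable fun x : ℝ => poissonMeasure (b * x.toNNReal) {n} :=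
    (Measure.measurable_coe (measurableSet_singleton n)).comp
      (measurable_poissonMeasure.comp (by fun_prop))
  have hm3 (n : ℕ) : AEMeasurable (fun x : ℝ => poissonMeasure (b * x.toNNReal) {n} *
      ∫⁻ y, f (x, y) ∂gammaMeasure (a + n) (1 + b)) (gammaMeasure a 1) :=
    ((hm2 n).mul (hm n)).aemeasurable
  rw [lintegral_tsum hm3]
  exact tsum_congr fun n => poisson_smul_gammaMeasure ha b n (hm n)

theorem map_fst_oneDimAlgorithm {a : ℝ} (ha : 0 < a) (b : ℝ≥0∞) :
    (oneDimAlgorithm a b).map Prod.fst = gammaMeasure a 1 := by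
  by_cases hb : b = ⊤
  · rw [oneDimAlgorithm, if_pos hb, Measure.map_map (by fun_prop) (by fun_prop)]
    exact Measure.map_id
  · refine Measure.ext_of_lintegral _ fun f hf => ?_
    rw [lintegral_map hf measurable_fst, lintegral_oneDimAlgorithm ha hb (by fun_prop)]
    refine lintegral_congr fun x => ?_
    have := isProbabilityMeasure_poissonGamma ha b.toNNReal x
    simp

/-- For finite `b`, given `N` the two coordinates are independent with the same law, hence
exchangeable. The second marginal is then read off from the first. -/
theorem map_swap_oneDimAlgorithm {a : ℝ} (ha : 0 < a) (b : ℝ≥0∞) :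
    (oneDimAlgorithm a b).map Prod.swap = oneDimAlgorithm a b := by
  by_cases hb : b = ⊤
  · rw [oneDimAlgorithm, if_pos hb, Measure.map_map (by fun_prop) (by fun_prop)]
    rfl
  · lift b to ℝ≥0 using hb
    refine Measure.ext_of_lintegral _ fun f hf => ?_
    have (n : ℕ) : IsProbabilityMeasure (gammaMeasure (a + n) (1 + b)) :=
      isProbabilityMeasure_gammaMeasure (by positivity) (by positivity)
    rw [lintegral_map hf measurable_swap, lintegral_oneDimAlgorithm_eq_tsum ha b (by fun_prop),
      lintegral_oneDimAlgorithm_eq_tsum ha b hf]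
    refine tsum_congr fun n => ?_
    congr 1
    rw [lintegral_lintegral_swap]
    · rfl
    · exact (hf.comp measurable_swap).aemeasurable

theorem map_snd_oneDimAlgorithm {a : ℝ} (ha : 0 < a) (b : ℝ≥0∞) :
    (oneDimAlgorithm a b).map Prod.snd = gammaMeasure a 1 := by
  rw [← map_fst_oneDimAlgorithm ha b, ← map_swap_oneDimAlgorithm ha b,
    Measure.map_map measurable_snd measurable_swap, map_swap_oneDimAlgorithm ha b]
  rfl

/-- For finite `b`, the coordinates given `N` are independent with atomless laws, so they almost
surely differ. -/
theorem oneDimAlgorithm_diagonal {a : ℝ} (ha : 0 < a) (b : ℝ≥0∞) :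
    oneDimAlgorithm a b {p | p.1 = p.2} = if b = ⊤ then 1 else 0 := by
  have hs : MeasurableSet {p : ℝ × ℝ | p.1 = p.2} := measurableSet_eq_fun measurable_fst measurable_snd
  split_ifs with hb
  · have := isProbabilityMeasure_gammaMeasure ha one_pos
    rw [oneDimAlgorithm, if_pos hb, Measure.map_apply (by fun_prop) hs]
    simp
  · lift b to ℝ≥0 using hb
    rw [← lintegral_indicator_one hs,
      lintegral_oneDimAlgorithm_eq_tsum ha b (measurable_one.indicator hs), ENNReal.tsum_eq_zero]
    intro n
    have h (x : ℝ) : ∫⁻ y, {p : ℝ × ℝ | p.1 = p.2}.indicator 1 (x, y)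
        ∂gammaMeasure (a + n) (1 + b) = 0 := by
      have : (fun y => {p : ℝ × ℝ | p.1 = p.2}.indicator (1 : ℝ × ℝ → ℝ≥0∞) (x, y)) =
          ({x} : Set ℝ).indicator 1 := by
        ext y
        simp [Set.indicator_apply, eq_comm]
      rw [this, lintegral_indicator_one (measurableSet_singleton x), measure_singleton]
    simp [h]

theorem integrable_pow_mul_pow_oneDimAlgorithm {a : ℝ} (ha : 0 < a) (b : ℝ≥0∞) (j k : ℕ) :
    Integrable (fun p => p.1 ^ j * p.2 ^ k) (oneDimAlgorithm a b) ∧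
    ∫ p, p.1 ^ j * p.2 ^ k ∂oneDimAlgorithm a b =
      rising a j * rising a k * ∑ m ∈ Finset.range (k + 1),
        (j.choose m : ℝ) * (k.choose m : ℝ) *
          (ratio b ^ m * ((m.factorial : ℝ) / rising a m)) := by
  have h1 := ae_of_ae_map (f := Prod.fst) (by fun_prop)
    ((map_fst_oneDimAlgorithm ha b).symm ▸ ae_pos_gammaMeasure a 1)
  have h2 := ae_of_ae_map (f := Prod.snd) (by fun_prop)
    ((map_snd_oneDimAlgorithm ha b).symm ▸ ae_pos_gammaMeasure a 1)
  refine integrable_and_integral_eq_of_lintegral (by fun_prop) ?_ ?_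
    (lintegral_pow_mul_pow_oneDimAlgorithm ha b j k)
  · filter_upwards [h1, h2] with p h1 h2
    simp only [Pi.zero_apply]
    positivity
  · have := rising_pos ha j
    have := rising_pos ha k
    have := ratio_nonneg b
    have h3 := rising_pos ha
    refine mul_nonneg (by positivity) (Finset.sum_nonneg fun m _ => ?_)
    have := h3 m
    positivity

/-! ### Determinacy by moments under exponential integrability -/

theorem zero_mem_interior_integrableExpSet {E : Type*} [NormedAddCommGroup E] [NormedSpace ℝ E]
    [MeasurableSpace E] [BorelSpace E] {μ : Measure E} {c : ℝ} (hc : 0 < c)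
    (hμ : Integrable (fun v => Real.exp (c * ‖v‖)) μ) (L : StrongDual ℝ E) :
    (0 : ℝ) ∈ interior (integrableExpSet L μ) := by
  -- Adding one to `‖L‖` keeps the radius meaningful when `L = 0`.
  have hd : 0 < c / (‖L‖ + 1) := by positivity
  rw [mem_interior]
  refine ⟨Metric.ball 0 (c / (‖L‖ + 1)), fun t ht => ?_, Metric.isOpen_ball,
    Metric.mem_ball_self hd⟩
  refine hμ.mono' (by fun_prop) (Filter.Eventually.of_forall fun v => ?_)
  rw [Real.norm_eq_abs, Real.abs_exp, Real.exp_le_exp]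
  rw [mem_ball_zero_iff, Real.norm_eq_abs, lt_div_iff₀ (by positivity)] at ht
  calc t * L v ≤ |t| * |L v| := by rw [← abs_mul]; exact le_abs_self _
    _ ≤ |t| * (‖L‖ * ‖v‖) := by gcongr; exact L.le_opNorm v
    _ ≤ (|t| * (‖L‖ + 1)) * ‖v‖ := by nlinarith [abs_nonneg t, norm_nonneg v]
    _ ≤ c * ‖v‖ := by gcongr

/-- Two finite measures with finite exponential moments are equal when all continuous linear
functionals have the same moments under both. -/
theorem ext_of_dual_moments {E : Type*} [NormedAddCommGroup E] [NormedSpace ℝ E]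
    [MeasurableSpace E] [BorelSpace E] [SecondCountableTopology E] [CompleteSpace E]
    {μ ν : Measure E} [IsFiniteMeasure μ] [IsFiniteMeasure ν] {c : ℝ} (hc : 0 < c)
    (hμ : Integrable (fun v => Real.exp (c * ‖v‖)) μ)
    (hν : Integrable (fun v => Real.exp (c * ‖v‖)) ν)
    (h : ∀ (L : StrongDual ℝ E) (n : ℕ), ∫ v, L v ^ n ∂μ = ∫ v, L v ^ n ∂ν) : μ = ν := by
  refine Measure.ext_of_charFunDual (funext fun L => ?_)
  have h0μ := zero_mem_interior_integrableExpSet hc hμ L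
  have h0ν := zero_mem_interior_integrableExpSet hc hν L
  set S : Set ℝ := interior (integrableExpSet L μ) ∩ interior (integrableExpSet L ν)
  have hS : Convex ℝ S := convex_integrableExpSet.interior.inter convex_integrableExpSet.interior
  have hpre : IsPreconnected (Complex.re ⁻¹' S) :=
    (hS.linear_preimage Complex.reLm).isPreconnected
  -- The derivatives at the origin are the moments, so the two power series there agree.
  have heq : complexMGF L μ =ᶠ[nhds 0] complexMGF L ν := by
    have aμ := (analyticAt_complexMGF (z := 0) (X := L) (μ := μ) (by simpa using h0μ))
    have aν := (analyticAt_complexMGF (z := 0) (X := L) (μ := ν) (by simpa using h0ν))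
    have pμ := aμ.hasFPowerSeriesAt
    have pν := aν.hasFPowerSeriesAt
    have hder (n : ℕ) : iteratedDeriv n (complexMGF L μ) 0 =
        iteratedDeriv n (complexMGF L ν) 0 := by
      rw [iteratedDeriv_complexMGF (by simpa using h0μ),
        iteratedDeriv_complexMGF (by simpa using h0ν)]
      simp only [zero_mul, Complex.exp_zero, mul_one]
      have := h L n
      rw [← Complex.ofReal_inj, ← integral_complex_ofReal, ← integral_complex_ofReal] at this
      simpa using this
    simp_rw [hder] at pμ
    have := (pμ.sub pν)
    rw [sub_self] at this
    filter_upwards [this.eventually_eq_zero] with z hz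
    simpa [sub_eq_zero] using hz
  -- The identity theorem propagates equality to the vertical strip over `S`, which contains the
  -- imaginary axis; the value at `I` is the characteristic function at `L`.
  have hEq := AnalyticOnNhd.eqOn_of_preconnected_of_eventuallyEq
    (analyticOnNhd_complexMGF.mono fun z hz => hz.1)
    (analyticOnNhd_complexMGF.mono fun z hz => hz.2) hpre
    (show (0 : ℂ) ∈ Complex.re ⁻¹' S from ⟨h0μ, h0ν⟩) heq
  have hI := hEq (show Complex.I ∈ Complex.re ⁻¹' S by
    refine ⟨?_, ?_⟩ <;> simpa)
  simpa only [complexMGF, charFunDual_apply, mul_comm Complex.I] using hI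

/-! ### Laguerre polynomials and binomial inversion -/

/-- The Laguerre polynomial divided by its value at the origin, up to sign. -/
noncomputable def scaledLaguerre (a : ℝ) (n : ℕ) (x : ℝ) : ℝ :=
  ∑ k ∈ Finset.range (n + 1), ((n.choose k : ℝ) * (-1) ^ (n - k)) * (x ^ k / rising a k)

theorem monicLaguerre_eq (n : ℕ) (a x : ℝ) :
    monicLaguerre n a x = rising a n * scaledLaguerre a n x := by
  rw [monicLaguerre, laguerre, scaledLaguerre]
  have hn : (n.factorial : ℝ) ≠ 0 := by positivity
  rw [show ∀ S : ℝ, (n.factorial : ℝ) * (-1) ^ n * (rising a n / n.factorial * S) =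
    rising a n * ((-1) ^ n * S) by intro S; field_simp, Finset.mul_sum]
  congr 1
  refine Finset.sum_congr rfl fun k hk => ?_
  have hkn : k ≤ n := by simpa [Nat.lt_succ_iff] using hk
  -- `(-n)_k = (-1)^k k! C(n,k)` turns the hypergeometric coefficients into signed binomial ones.
  rw [ascPochhammer_eval_neg_eq_descPochhammer, descPochhammer_eval_eq_descFactorial,
    Nat.descFactorial_eq_factorial_mul_choose]
  have hk : (k.factorial : ℝ) ≠ 0 := by positivity
  have hs : (-1 : ℝ) ^ n = (-1) ^ (n - k) * (-1) ^ k := by rw [← pow_add]; congr; omega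
  have hs2 : (-1 : ℝ) ^ k * (-1) ^ k = 1 := by rw [← mul_pow]; simp
  rw [hs]
  push_cast
  field_simp
  linear_combination x ^ k * (n.choose k : ℝ) / rising a k * hs2

/-- Coefficient of `X^j` in `((X - 1) + 1)^k = X^k`: the inversion with the two matrices in the
other order. -/
theorem sum_choose_mul_choose' (k j : ℕ) :
    ∑ m ∈ Finset.range (k + 1), (k.choose m : ℝ) * ((m.choose j : ℝ) * (-1) ^ (m - j)) =
      if k = j then 1 else 0 := by
  have h := congrArg (fun p : Polynomial ℝ => p.coeff j)
    (add_pow (Polynomial.X + Polynomial.C (-1) : Polynomial ℝ) 1 k)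
  have e (m : ℕ) : ((Polynomial.X + Polynomial.C (-1) : Polynomial ℝ) ^ m * 1 ^ (k - m) *
      (k.choose m : Polynomial ℝ)) =
      Polynomial.C (k.choose m : ℝ) * (Polynomial.X + Polynomial.C (-1)) ^ m := by
    simp; ring
  have e' : (Polynomial.X + Polynomial.C (-1) + 1 : Polynomial ℝ) = Polynomial.X := by simp
  simp only [e, e', Polynomial.finsetSum_coeff, Polynomial.coeff_C_mul,
    Polynomial.coeff_X_add_C_pow, Polynomial.coeff_X_pow] at h
  rw [Finset.sum_congr rfl fun m _ => by rw [mul_comm (m.choose j : ℝ)], ← h]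
  simp [eq_comm]

theorem pow_div_rising_eq_sum (a x : ℝ) (k : ℕ) :
    x ^ k / rising a k =
      ∑ m ∈ Finset.range (k + 1), (k.choose m : ℝ) * scaledLaguerre a m x := by
  have e (m : ℕ) (hm : m ∈ Finset.range (k + 1)) : scaledLaguerre a m x =
      ∑ j ∈ Finset.range (k + 1), ((m.choose j : ℝ) * (-1) ^ (m - j)) * (x ^ j / rising a j) := by
    refine Finset.sum_subset ?_ fun i _ hi => ?_
    · rw [Finset.range_subset_range]; simp at hm; omega
    · rw [Nat.choose_eq_zero_of_lt (n := m)]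
      · simp
      · simp at hi; omega
  rw [Finset.sum_congr rfl fun m hm => by rw [e m hm, Finset.mul_sum], Finset.sum_comm]
  simp_rw [← mul_assoc _ _ (x ^ _ / _), ← Finset.sum_mul, sum_choose_mul_choose']
  simp

/-- The normalizing constant between product Laguerre polynomials and products of scaled Laguerre
polynomials. -/
noncomputable def laguerreConst {d : ℕ} (α : Fin d → ℝ) (n : Fin d → ℕ) : ℝ :=
  ∏ i, rising (α i) (n i) / Real.sqrt (laguerreNormSq (n i) (α i))

/-- The squared norm of the product of scaled Laguerre polynomials. -/
noncomputable def scaledNormSq {d : ℕ} (α : Fin d → ℝ) (n : Fin d → ℕ) : ℝ :=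
  ∏ i, ((n i).factorial : ℝ) / rising (α i) (n i)

variable {d : ℕ} {α : Fin d → ℝ}

theorem productLaguerre_eq (α : Fin d → ℝ) (n : Fin d → ℕ) (x : Fin d → ℝ) :
    productLaguerre α n x = laguerreConst α n * ∏ i, scaledLaguerre (α i) (n i) (x i) := by
  rw [productLaguerre, laguerreConst, ← Finset.prod_mul_distrib]
  exact Finset.prod_congr rfl fun i _ => by rw [monicLaguerre_eq]; ring

theorem laguerreConst_sq (hα : ∀ i, 0 < α i) (n : Fin d → ℕ) :
    laguerreConst α n * laguerreConst α n * scaledNormSq α n = 1 := by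
  rw [laguerreConst, scaledNormSq, ← Finset.prod_mul_distrib, ← Finset.prod_mul_distrib]
  refine Finset.prod_eq_one fun i _ => ?_
  have h := rising_pos (hα i) (n i)
  have h2 : 0 < laguerreNormSq (n i) (α i) := by unfold laguerreNormSq; positivity
  rw [div_mul_div_comm, Real.mul_self_sqrt h2.le, laguerreNormSq]
  have : (ascPochhammer ℝ (n i)).eval (α i) ≠ 0 := h.ne'
  simp only [rising]
  field_simp

theorem laguerreConst_ne_zero (hα : ∀ i, 0 < α i) (n : Fin d → ℕ) : laguerreConst α n ≠ 0 := by
  intro h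
  have := laguerreConst_sq hα n
  simp [h] at this

theorem scaledLaguerre_mul (a : ℝ) (n m : ℕ) (x y : ℝ) :
    scaledLaguerre a n x * scaledLaguerre a m y =
      ∑ j ∈ Finset.range (n + 1), ∑ k ∈ Finset.range (m + 1),
        ((n.choose j : ℝ) * (-1) ^ (n - j)) * ((m.choose k : ℝ) * (-1) ^ (m - k)) /
          (rising a j * rising a k) * (x ^ j * y ^ k) := by
  rw [scaledLaguerre, scaledLaguerre, Finset.sum_mul_sum]
  refine Finset.sum_congr rfl fun j _ => Finset.sum_congr rfl fun k _ => ?_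
  rw [div_mul_eq_mul_div, ← mul_div_assoc, ← mul_div_assoc, div_mul_div_comm]
  ring

/-- The normalized moment matrix is a diagonal matrix between two binomial matrices, and the
coefficients of the scaled Laguerre polynomials invert both of these. -/
theorem integral_scaledLaguerre_oneDimAlgorithm {a : ℝ} (ha : 0 < a) (b : ℝ≥0∞) (n m : ℕ) :
    ∫ p, scaledLaguerre a n p.1 * scaledLaguerre a m p.2 ∂oneDimAlgorithm a b =
      if n = m then (n.factorial : ℝ) / rising a n * ratio b ^ n else 0 := by
  simp_rw [scaledLaguerre_mul]
  have hi := integrable_pow_mul_pow_oneDimAlgorithm ha b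
  rw [integral_finsetSum _ fun j _ => integrable_finsetSum _ fun k _ => (hi j k).1.const_mul _]
  simp_rw [integral_finsetSum _ fun k _ => (hi _ k).1.const_mul _, integral_const_mul, (hi _ _).2]
  set w : ℕ → ℝ := fun i => ratio b ^ i * ((i.factorial : ℝ) / rising a i)
  -- Zero terms extend the inner sum to a range independent of `k`, so that the sums can be
  -- interchanged.
  have e (j k : ℕ) (hk : k ∈ Finset.range (m + 1)) :
      ((n.choose j : ℝ) * (-1) ^ (n - j)) * ((m.choose k : ℝ) * (-1) ^ (m - k)) /
          (rising a j * rising a k) * (rising a j * rising a k * ∑ i ∈ Finset.range (k + 1),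
            (j.choose i : ℝ) * (k.choose i : ℝ) * w i) =
        ∑ i ∈ Finset.range (m + 1), w i * ((((n.choose j : ℝ) * (-1) ^ (n - j)) * (j.choose i : ℝ)) *
          (((m.choose k : ℝ) * (-1) ^ (m - k)) * (k.choose i : ℝ))) := by
    have h1 := (rising_pos ha j).ne'
    have h2 := (rising_pos ha k).ne'
    have : ∑ i ∈ Finset.range (k + 1), (j.choose i : ℝ) * (k.choose i : ℝ) * w i =
        ∑ i ∈ Finset.range (m + 1), (j.choose i : ℝ) * (k.choose i : ℝ) * w i := by
      refine Finset.sum_subset ?_ fun i _ hi => ?_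
      · rw [Finset.range_subset_range]; simp at hk; omega
      · rw [Nat.choose_eq_zero_of_lt (n := k)]
        · simp
        · simp at hi; omega
    rw [this, ← mul_assoc, div_mul_cancel₀ _ (mul_ne_zero h1 h2), Finset.mul_sum]
    exact Finset.sum_congr rfl fun i _ => by ring
  rw [Finset.sum_congr rfl fun j _ => Finset.sum_congr rfl fun k hk => e j k hk]
  rw [Finset.sum_congr rfl fun j _ => Finset.sum_comm, Finset.sum_comm]
  simp_rw [← Finset.mul_sum, ← Finset.sum_mul, sum_choose_mul_choose]
  rcases eq_or_ne n m with h | h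
  · subst h
    rw [Finset.sum_eq_single n]
    · simp [w, mul_comm]
    · intro i _ hi
      simp [hi.symm]
    · simp
  · rw [if_neg h]
    refine Finset.sum_eq_zero fun i _ => ?_
    by_cases h1 : n = i
    · subst h1; simp [h.symm]
    · simp [h1]

/-! ### Square integrability and correlations of laws with gamma marginals -/

theorem memLp_pow_gammaMeasure {a : ℝ} (ha : 0 < a) (k : ℕ) :
    MemLp (fun x => x ^ k) 2 (gammaMeasure a 1) := by
  rw [memLp_two_iff_integrable_sq (by fun_prop)]
  simp_rw [← pow_mul]
  refine (integrable_and_integral_eq_of_lintegral (by fun_prop) ?_ ?_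
    (lintegral_pow_gammaMeasure ha one_pos (k * 2))).1
  · exact Filter.Eventually.of_forall fun x => (Even.mul_left even_two k).pow_nonneg x
  · have := rising_pos ha (k * 2)
    positivity

theorem memLp_scaledLaguerre {a : ℝ} (ha : 0 < a) (n : ℕ) :
    MemLp (scaledLaguerre a n) 2 (gammaMeasure a 1) := by
  unfold scaledLaguerre
  exact memLp_finsetSum _ fun k _ => by
    simpa only [div_eq_inv_mul] using ((memLp_pow_gammaMeasure ha k).const_mul _).const_mul _

theorem isProbabilityMeasure_productGamma (hα : ∀ i, 0 < α i) :
    IsProbabilityMeasure (productGamma α) := by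
  have (i : Fin d) := isProbabilityMeasure_gammaMeasure (hα i) one_pos
  unfold productGamma
  infer_instance

theorem memLp_prod_productGamma (hα : ∀ i, 0 < α i) {f : Fin d → ℝ → ℝ}
    (hf : ∀ i, MemLp (f i) 2 (gammaMeasure (α i) 1)) :
    MemLp (fun x : Fin d → ℝ => ∏ i, f i (x i)) 2 (productGamma α) := by
  have (i : Fin d) := isProbabilityMeasure_gammaMeasure (hα i) one_pos
  rw [memLp_two_iff_integrable_sq]
  · simp_rw [← Finset.prod_pow]
    exact Integrable.fintype_prod (f := fun i x => f i x ^ 2) fun i => (hf i).integrable_sq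
  · refine Finset.aestronglyMeasurable_fun_prod _ fun i _ => ?_
    exact (hf i).1.comp_measurePreserving (measurePreserving_eval _ i)

/-- A law on pairs both of whose marginals are product gamma. -/
structure HasGammaMarginals (α : Fin d → ℝ) (μ : Measure ((Fin d → ℝ) × (Fin d → ℝ))) : Prop where
  fst : MeasurePreserving Prod.fst μ (productGamma α)
  snd : MeasurePreserving Prod.snd μ (productGamma α)

theorem HasGammaMarginals.integrable {μ : Measure ((Fin d → ℝ) × (Fin d → ℝ))}
    (h : HasGammaMarginals α μ) (hα : ∀ i, 0 < α i) {f g : Fin d → ℝ → ℝ}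
    (hf : ∀ i, MemLp (f i) 2 (gammaMeasure (α i) 1))
    (hg : ∀ i, MemLp (g i) 2 (gammaMeasure (α i) 1)) :
    Integrable (fun p => (∏ i, f i (p.1 i)) * ∏ i, g i (p.2 i)) μ :=
  ((memLp_prod_productGamma hα hf).comp_measurePreserving h.fst).integrable_mul
    ((memLp_prod_productGamma hα hg).comp_measurePreserving h.snd)

/-- `ρ` is the canonical correlation sequence of the law `μ`. -/
def HasCorrelations (α : Fin d → ℝ) (μ : Measure ((Fin d → ℝ) × (Fin d → ℝ)))
    (ρ : (Fin d → ℕ) → ℝ) : Prop :=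
  ∀ n m : Fin d → ℕ,
    ∫ p, productLaguerre α n p.1 * productLaguerre α m p.2 ∂μ = if n = m then ρ n else 0

theorem hasCorrelations_iff (hα : ∀ i, 0 < α i) {μ : Measure ((Fin d → ℝ) × (Fin d → ℝ))}
    {ρ : (Fin d → ℕ) → ℝ} : HasCorrelations α μ ρ ↔ ∀ n m : Fin d → ℕ,
      ∫ p, (∏ i, scaledLaguerre (α i) (n i) (p.1 i)) * (∏ i, scaledLaguerre (α i) (m i) (p.2 i)) ∂μ
        = if n = m then scaledNormSq α n * ρ n else 0 := by
  have hc := laguerreConst_ne_zero hα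
  refine forall₂_congr fun n m => ?_
  have e (p : (Fin d → ℝ) × (Fin d → ℝ)) : productLaguerre α n p.1 * productLaguerre α m p.2 =
      (laguerreConst α n * laguerreConst α m) *
        ((∏ i, scaledLaguerre (α i) (n i) (p.1 i)) * (∏ i, scaledLaguerre (α i) (m i) (p.2 i))) := by
    rw [productLaguerre_eq, productLaguerre_eq]; ring
  simp_rw [e, integral_const_mul]
  split_ifs with h
  · subst h
    have := laguerreConst_sq hα n
    rw [← mul_right_inj' (mul_ne_zero (hc n) (hc n)) (b := integral _ _), ← mul_assoc _ _ (ρ n),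
      this, one_mul]
  · simp [hc]

/-- Mixed moments of a law with canonical correlations. -/
theorem HasCorrelations.integral_pow {μ : Measure ((Fin d → ℝ) × (Fin d → ℝ))}
    {ρ : (Fin d → ℕ) → ℝ} (h : HasCorrelations α μ ρ) (hμ : HasGammaMarginals α μ)
    (hα : ∀ i, 0 < α i) (j k : Fin d → ℕ) :
    ∫ p, (∏ i, p.1 i ^ j i) * (∏ i, p.2 i ^ k i) ∂μ =
      ∑ m ∈ Fintype.piFinset fun i => Finset.range (k i + 1),
        (∏ i, rising (α i) (j i) * rising (α i) (k i) *
          (((j i).choose (m i) : ℝ) * ((k i).choose (m i) : ℝ) *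
            (((m i).factorial : ℝ) / rising (α i) (m i)))) * ρ m := by
  rw [hasCorrelations_iff hα] at h
  have e (k : Fin d → ℕ) (x : Fin d → ℝ) : ∏ i, x i ^ k i =
      ∑ m ∈ Fintype.piFinset fun i => Finset.range (k i + 1),
        (∏ i, rising (α i) (k i) * ((k i).choose (m i) : ℝ)) *
          ∏ i, scaledLaguerre (α i) (m i) (x i) := by
    simp_rw [← Finset.prod_mul_distrib]
    rw [← Finset.prod_univ_sum (fun i => Finset.range (k i + 1)) (fun i m =>
      rising (α i) (k i) * ((k i).choose m : ℝ) * scaledLaguerre (α i) m (x i))]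
    refine Finset.prod_congr rfl fun i _ => ?_
    simp_rw [mul_assoc]
    rw [← Finset.mul_sum, ← pow_div_rising_eq_sum, mul_div_cancel₀ _ (rising_pos (hα i) _).ne']
  simp_rw [e j, e k, Finset.sum_mul_sum]
  have hint (n m : Fin d → ℕ) := hμ.integrable hα (fun i => memLp_scaledLaguerre (hα i) (n i))
    (fun i => memLp_scaledLaguerre (hα i) (m i))
  have e2 (A B C D : ℝ) : A * B * (C * D) = (A * C) * (B * D) := by ring
  simp_rw [e2]
  rw [integral_finsetSum _ fun n _ => integrable_finsetSum _ fun m _ => (hint n m).const_mul _]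
  simp_rw [integral_finsetSum _ fun m _ => (hint _ m).const_mul _, integral_const_mul, h]
  rw [Finset.sum_comm]
  refine Finset.sum_congr rfl fun m _ => ?_
  by_cases hm : m ∈ Fintype.piFinset fun i => Finset.range (j i + 1)
  · rw [Finset.sum_eq_single_of_mem m hm fun n _ hn => by simp [hn], if_pos rfl, scaledNormSq,
      ← Finset.prod_mul_distrib, ← mul_assoc, ← Finset.prod_mul_distrib]
    congr 1
    exact Finset.prod_congr rfl fun i _ => by ring
  -- If some `m i > j i`, no index on the left equals `m`, and on the right `C(j i, m i) = 0`.
  · have hne (n : Fin d → ℕ) (hn : n ∈ Fintype.piFinset fun i => Finset.range (j i + 1)) :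
        n ≠ m := fun e => hm (e ▸ hn)
    rw [Finset.sum_eq_zero fun n hn => by rw [if_neg (hne n hn), mul_zero]]
    simp only [Fintype.mem_piFinset, not_forall] at hm
    obtain ⟨i, hi⟩ := hm
    rw [Finset.prod_eq_zero (Finset.mem_univ i), zero_mul]
    rw [Nat.choose_eq_zero_of_lt (n := j i)]
    · simp
    · simp at hi; omega

/-! ### The mixture algorithm -/

/-- The kernel of `d` independent one-dimensional runs. -/
noncomputable def runKernel (hα : ∀ i, 0 < α i) : Kernel (Fin d → ℝ≥0∞) (Fin d → ℝ × ℝ) :=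
  ⟨fun b => Measure.pi fun j => oneDimAlgorithm (α j) (b j), measurable_pi_oneDimAlgorithm hα⟩

theorem mixtureAlgorithm_eq (hα : ∀ i, 0 < α i) (Pstar : Measure (Fin d → ℝ≥0∞)) :
    mixtureAlgorithm α Pstar =
      (runKernel hα ∘ₘ Pstar).map fun v => (fun j => (v j).1, fun j => (v j).2) := rfl

theorem lintegral_mixtureAlgorithm (hα : ∀ i, 0 < α i) (Pstar : Measure (Fin d → ℝ≥0∞))
    {f : (Fin d → ℝ) × (Fin d → ℝ) → ℝ≥0∞} (hf : Measurable f) :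
    ∫⁻ p, f p ∂mixtureAlgorithm α Pstar =
      ∫⁻ b, ∫⁻ v, f (fun j => (v j).1, fun j => (v j).2)
        ∂Measure.pi (fun j => oneDimAlgorithm (α j) (b j)) ∂Pstar := by
  rw [mixtureAlgorithm_eq hα, lintegral_map hf (by fun_prop),
    Measure.lintegral_bind (Kernel.aemeasurable _) (by fun_prop)]
  rfl

theorem hasGammaMarginals_mixtureAlgorithm (hα : ∀ i, 0 < α i) (Pstar : Measure (Fin d → ℝ≥0∞))
    [IsProbabilityMeasure Pstar] : HasGammaMarginals α (mixtureAlgorithm α Pstar) := by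
  have h1 (b : Fin d → ℝ≥0∞) (j : Fin d) : IsProbabilityMeasure (oneDimAlgorithm (α j) (b j)) :=
    isProbabilityMeasure_oneDimAlgorithm (hα j) (b j)
  constructor
  · refine ⟨measurable_fst, Measure.ext_of_lintegral _ fun f hf => ?_⟩
    rw [lintegral_map hf measurable_fst, lintegral_mixtureAlgorithm hα _ (by fun_prop)]
    have (b : Fin d → ℝ≥0∞) : ∫⁻ v, f (fun j => (v j).1)
        ∂Measure.pi (fun j => oneDimAlgorithm (α j) (b j)) = ∫⁻ x, f x ∂productGamma α := by
      have (j : Fin d) : SigmaFinite ((oneDimAlgorithm (α j) (b j)).map Prod.fst) := by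
        rw [map_fst_oneDimAlgorithm (hα j)]
        have := isProbabilityMeasure_gammaMeasure (hα j) one_pos
        infer_instance
      have h := Measure.pi_map_pi (μ := fun j => oneDimAlgorithm (α j) (b j))
        (f := fun _ => Prod.fst) fun j => measurable_fst.aemeasurable
      simp_rw [map_fst_oneDimAlgorithm (hα _)] at h
      rw [productGamma, ← h, lintegral_map hf (by fun_prop)]
    simp [this]
  · refine ⟨measurable_snd, Measure.ext_of_lintegral _ fun f hf => ?_⟩
    rw [lintegral_map hf measurable_snd, lintegral_mixtureAlgorithm hα _ (by fun_prop)]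
    have (b : Fin d → ℝ≥0∞) : ∫⁻ v, f (fun j => (v j).2)
        ∂Measure.pi (fun j => oneDimAlgorithm (α j) (b j)) = ∫⁻ x, f x ∂productGamma α := by
      have (j : Fin d) : SigmaFinite ((oneDimAlgorithm (α j) (b j)).map Prod.snd) := by
        rw [map_snd_oneDimAlgorithm (hα j)]
        have := isProbabilityMeasure_gammaMeasure (hα j) one_pos
        infer_instance
      have h := Measure.pi_map_pi (μ := fun j => oneDimAlgorithm (α j) (b j))
        (f := fun _ => Prod.snd) fun j => measurable_snd.aemeasurable
      simp_rw [map_snd_oneDimAlgorithm (hα _)] at h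
      rw [productGamma, ← h, lintegral_map hf (by fun_prop)]
    simp [this]

theorem mixtureAlgorithm_diagonal (hα : ∀ i, 0 < α i) (Pstar : Measure (Fin d → ℝ≥0∞))
    (i : Fin d) :
    mixtureAlgorithm α Pstar {p | p.1 i = p.2 i} = Pstar {b | b i = ⊤} := by
  have hs : MeasurableSet {p : (Fin d → ℝ) × (Fin d → ℝ) | p.1 i = p.2 i} :=
    measurableSet_eq_fun (by fun_prop) (by fun_prop)
  have ht : MeasurableSet {p : ℝ × ℝ | p.1 = p.2} := measurableSet_eq_fun (by fun_prop) (by fun_prop)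
  have hu : MeasurableSet {b : Fin d → ℝ≥0∞ | b i = ⊤} :=
    (measurableSet_singleton ⊤).preimage (measurable_pi_apply i)
  have h1 (b : Fin d → ℝ≥0∞) (j : Fin d) : IsProbabilityMeasure (oneDimAlgorithm (α j) (b j)) :=
    isProbabilityMeasure_oneDimAlgorithm (hα j) (b j)
  rw [← lintegral_indicator_one hs, ← lintegral_indicator_one hu,
    lintegral_mixtureAlgorithm hα _ (measurable_one.indicator hs)]
  refine lintegral_congr fun b => ?_
  have h2 := (measurePreserving_eval (fun j => oneDimAlgorithm (α j) (b j)) i).lintegral_comp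
    (measurable_one.indicator ht)
  rw [lintegral_indicator_one ht, oneDimAlgorithm_diagonal (hα i)] at h2
  have e (v : Fin d → ℝ × ℝ) : {p : (Fin d → ℝ) × (Fin d → ℝ) | p.1 i = p.2 i}.indicator
      (1 : (Fin d → ℝ) × (Fin d → ℝ) → ℝ≥0∞) (fun j => (v j).1, fun j => (v j).2) =
      {p : ℝ × ℝ | p.1 = p.2}.indicator 1 (Function.eval i v) := by
    simp [Set.indicator_apply]
  simp_rw [e, h2]
  simp [Set.indicator_apply]

theorem measurable_ratio : Measurable ratio := by
  unfold ratio
  exact Measurable.ite (measurableSet_singleton _) measurable_const (by fun_prop)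

/-- Given `B = b` the coordinate pairs are independent, so the integral is a product of
one-dimensional ones. A single index with `n i ≠ m i` annihilates it. -/
theorem hasCorrelations_mixtureAlgorithm (hα : ∀ i, 0 < α i) (Pstar : Measure (Fin d → ℝ≥0∞))
    [IsProbabilityMeasure Pstar] :
    HasCorrelations α (mixtureAlgorithm α Pstar) fun n => ∫ b, ∏ i, ratio (b i) ^ n i ∂Pstar := by
  rw [hasCorrelations_iff hα]
  intro n m
  have hint := (hasGammaMarginals_mixtureAlgorithm hα Pstar).integrable hα
    (fun i => memLp_scaledLaguerre (hα i) (n i)) (fun i => memLp_scaledLaguerre (hα i) (m i))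
  rw [mixtureAlgorithm_eq hα] at hint ⊢
  rw [integral_map (by fun_prop) hint.1]
  rw [integrable_map_measure hint.1 (by fun_prop)] at hint
  rw [Measure.comp_eq_comp_const_apply] at hint ⊢
  refine (Kernel.integral_comp hint).trans ?_
  rw [Kernel.const_apply]
  have h1 (b : Fin d → ℝ≥0∞) (j : Fin d) : IsProbabilityMeasure (oneDimAlgorithm (α j) (b j)) :=
    isProbabilityMeasure_oneDimAlgorithm (hα j) (b j)
  have e (b : Fin d → ℝ≥0∞) : ∫ v, (∏ i, scaledLaguerre (α i) (n i) (v i).1) *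
      (∏ i, scaledLaguerre (α i) (m i) (v i).2) ∂runKernel hα b =
      ∏ i, if n i = m i then ((n i).factorial : ℝ) / rising (α i) (n i) * ratio (b i) ^ n i
        else 0 := by
    simp_rw [← Finset.prod_mul_distrib]
    refine (integral_fintype_prod_eq_prod (fun i (p : ℝ × ℝ) => scaledLaguerre (α i) (n i) p.1 *
      scaledLaguerre (α i) (m i) p.2)).trans ?_
    exact Finset.prod_congr rfl fun i _ => integral_scaledLaguerre_oneDimAlgorithm (hα i) _ _ _
  simp only [Function.comp_apply, e]
  split_ifs with h
  · subst h
    simp_rw [if_true, Finset.prod_mul_distrib, integral_const_mul]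
    rfl
  · obtain ⟨i, hi⟩ := Function.ne_iff.1 h
    have hz (b : Fin d → ℝ≥0∞) : ∏ i, (if n i = m i then
        ((n i).factorial : ℝ) / rising (α i) (n i) * ratio (b i) ^ n i else 0) = 0 :=
      Finset.prod_eq_zero (Finset.mem_univ i) (if_neg hi)
    simp [hz]

/-! ### Determinacy by the correlation sequence -/

theorem HasGammaMarginals.isProbabilityMeasure {μ : Measure ((Fin d → ℝ) × (Fin d → ℝ))}
    (hμ : HasGammaMarginals α μ) (hα : ∀ i, 0 < α i) : IsProbabilityMeasure μ := by
  have := isProbabilityMeasure_productGamma hα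
  refine ⟨?_⟩
  have h := hμ.fst.measure_preimage (s := Set.univ) nullMeasurableSet_univ
  rwa [Set.preimage_univ, measure_univ (μ := productGamma α)] at h

/-- The norm is a maximum of coordinates, so its exponential is at most a sum of coordinate
exponentials. The rate `1 / 2` is below the gamma rate one; the summand one covers `d = 0`. -/
theorem HasGammaMarginals.integrable_exp {μ : Measure ((Fin d → ℝ) × (Fin d → ℝ))}
    (hμ : HasGammaMarginals α μ) (hα : ∀ i, 0 < α i) :
    Integrable (fun p => Real.exp (1 / 2 * ‖p‖)) μ := by
  have (i : Fin d) := isProbabilityMeasure_gammaMeasure (hα i) one_pos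
  have := isProbabilityMeasure_productGamma hα
  have hprob : IsProbabilityMeasure μ := hμ.isProbabilityMeasure hα
  have h0 (i : Fin d) : Integrable (fun x : Fin d → ℝ => Real.exp (1 / 2 * |x i|))
      (productGamma α) := by
    have h1 : Integrable (fun x => Real.exp (1 / 2 * |x|)) (gammaMeasure (α i) 1) := by
      refine (integrable_exp_gammaMeasure (hα i) one_pos (c := 1 / 2) (by norm_num)).congr ?_
      filter_upwards [ae_pos_gammaMeasure (α i) 1] with x hx
      rw [abs_of_pos hx]
    exact (measurePreserving_eval (fun i => gammaMeasure (α i) 1) i).integrable_comp_of_integrable h1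
  have h1 := fun i => hμ.fst.integrable_comp_of_integrable (h0 i)
  have h2 := fun i => hμ.snd.integrable_comp_of_integrable (h0 i)
  refine (((integrable_const (1 : ℝ)).add (integrable_finsetSum Finset.univ fun i _ => h1 i)).add
    (integrable_finsetSum Finset.univ fun i _ => h2 i)).mono' (by fun_prop)
    (Filter.Eventually.of_forall fun p => ?_)
  have hb (x : Fin d → ℝ) : Real.exp (1 / 2 * ‖x‖) ≤ 1 + ∑ i, Real.exp (1 / 2 * |x i|) ∧
      0 ≤ ∑ i, Real.exp (1 / 2 * |x i|) := by
    have hs : 0 ≤ ∑ i, Real.exp (1 / 2 * |x i|) := Finset.sum_nonneg fun i _ => (Real.exp_pos _).le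
    refine ⟨?_, hs⟩
    rcases isEmpty_or_nonempty (Fin d) with hd | hd
    · simp [Subsingleton.elim x 0]
    · obtain ⟨i, hi⟩ := Finite.exists_max (fun i => ‖x i‖)
      have : ‖x‖ ≤ |x i| := (pi_norm_le_iff_of_nonempty _).2 hi
      have h3 : Real.exp (1 / 2 * |x i|) ≤ ∑ i, Real.exp (1 / 2 * |x i|) :=
        Finset.single_le_sum (f := fun i => Real.exp (1 / 2 * |x i|))
          (fun i _ => (Real.exp_pos _).le) (Finset.mem_univ i)
      have h4 : Real.exp (1 / 2 * ‖x‖) ≤ Real.exp (1 / 2 * |x i|) := by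
        rw [Real.exp_le_exp]; linarith
      linarith
  rw [Real.norm_eq_abs, Real.abs_exp]
  simp only [Pi.add_apply, Function.comp_apply]
  obtain ⟨a1, a2⟩ := hb p.1
  obtain ⟨b1, b2⟩ := hb p.2
  rcases max_cases ‖p.1‖ ‖p.2‖ with ⟨h, _⟩ | ⟨h, _⟩ <;> rw [Prod.norm_def, h] <;> linarith

/-- A law with gamma marginals is determined by its canonical correlation sequence. -/
theorem HasCorrelations.measure_eq {μ ν : Measure ((Fin d → ℝ) × (Fin d → ℝ))}
    {ρ : (Fin d → ℕ) → ℝ} (hα : ∀ i, 0 < α i) (hμ : HasGammaMarginals α μ)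
    (hν : HasGammaMarginals α ν) (h : HasCorrelations α μ ρ) (h' : HasCorrelations α ν ρ) :
    μ = ν := by
  have := isProbabilityMeasure_productGamma hα
  have : IsProbabilityMeasure μ := hμ.isProbabilityMeasure hα
  have : IsProbabilityMeasure ν := hν.isProbabilityMeasure hα
  have hint {μ : Measure ((Fin d → ℝ) × (Fin d → ℝ))} (hμ : HasGammaMarginals α μ)
      (j k : Fin d → ℕ) : Integrable (fun p => (∏ i, p.1 i ^ j i) * ∏ i, p.2 i ^ k i) μ :=
    hμ.integrable hα (f := fun i x => x ^ j i) (g := fun i x => x ^ k i)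
      (fun i => memLp_pow_gammaMeasure (hα i) _) (fun i => memLp_pow_gammaMeasure (hα i) _)
  have hpoly (q : MvPolynomial (Fin d ⊕ Fin d) ℝ) :
      ∫ p, MvPolynomial.eval (Sum.elim p.1 p.2) q ∂μ =
        ∫ p, MvPolynomial.eval (Sum.elim p.1 p.2) q ∂ν := by
    simp_rw [MvPolynomial.eval_eq', Fintype.prod_sum_type, Sum.elim_inl, Sum.elim_inr]
    rw [integral_finsetSum _ fun s _ =>
        (hint hμ (fun i => s (Sum.inl i)) fun i => s (Sum.inr i)).const_mul _,
      integral_finsetSum _ fun s _ =>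
        (hint hν (fun i => s (Sum.inl i)) fun i => s (Sum.inr i)).const_mul _]
    refine Finset.sum_congr rfl fun s _ => ?_
    rw [integral_const_mul, integral_const_mul, h.integral_pow hμ hα, h'.integral_pow hν hα]
  refine ext_of_dual_moments (c := 1 / 2) (by norm_num) (hμ.integrable_exp hα)
    (hν.integrable_exp hα) fun L n => ?_
  -- A power of a linear functional is a polynomial in the coordinates, so equality of mixed moments
  -- suffices.
  have hL (p : (Fin d → ℝ) × (Fin d → ℝ)) : L p ^ n =
      MvPolynomial.eval (Sum.elim p.1 p.2) ((∑ i, MvPolynomial.C (L (Pi.single i 1, 0)) *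
        MvPolynomial.X (Sum.inl i) + ∑ i, MvPolynomial.C (L (0, Pi.single i 1)) *
        MvPolynomial.X (Sum.inr i)) ^ n) := by
    have e1 := LinearMap.pi_apply_eq_sum_univ (L.toLinearMap ∘ₗ LinearMap.inl ℝ _ _) p.1
    have e2 := LinearMap.pi_apply_eq_sum_univ (L.toLinearMap ∘ₗ LinearMap.inr ℝ _ _) p.2
    have e3 : L p = L (p.1, 0) + L (0, p.2) := by rw [← map_add]; simp
    have e4 (i : Fin d) : (fun j => if i = j then (1 : ℝ) else 0) = Pi.single i 1 := by
      ext j; simp [Pi.single_apply, eq_comm]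
    simp only [LinearMap.comp_apply, LinearMap.inl_apply, LinearMap.inr_apply, smul_eq_mul,
      ContinuousLinearMap.coe_coe, e4] at e1 e2
    simp only [map_pow, map_add, map_sum, map_mul, MvPolynomial.eval_C, MvPolynomial.eval_X,
      Sum.elim_inl, Sum.elim_inr]
    rw [e3, e1, e2]
    simp_rw [mul_comm]
  simp_rw [hL]
  exact hpoly _

/-! ### Ratio moments under power weights -/

open Filter Topology in
-- Numerator and denominator are monic polynomials in `t`, of degrees `m` and `m + k`.
theorem tendsto_descFactorial_div_rising (a : ℝ) (m k : ℕ) :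
    Tendsto (fun t : ℕ => (t.descFactorial m : ℝ) / rising (a + t) (m + k)) atTop
      (𝓝 (if k = 0 then 1 else 0)) := by
  have hlin (c : ℝ) : Tendsto (fun t : ℕ => a + t + c) atTop atTop :=
    tendsto_atTop_add_const_right _ _ (tendsto_atTop_add_const_left _ _ tendsto_natCast_atTop_atTop)
  induction k with
  | zero =>
    induction m with
    | zero => simp [rising_zero]
    | succ m ih =>
      -- The factor gained from `m` to `m + 1` is `(t - m) / (a + t + m) = 1 - (a + 2m) / (a + t +
      -- m)`.
      have h1 : Tendsto (fun t : ℕ => 1 - (a + 2 * m) * (a + t + m)⁻¹) atTop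
          (𝓝 (1 - (a + 2 * m) * 0)) :=
        tendsto_const_nhds.sub (tendsto_const_nhds.mul (tendsto_inv_atTop_zero.comp (hlin m)))
      have h2 := ih.mul h1
      simp only [if_true, mul_zero, sub_zero, mul_one] at h2
      refine (h2.congr' ?_)
      filter_upwards [eventually_ge_atTop m, (hlin m).eventually_gt_atTop 0] with t ht hp
      rw [add_zero, add_zero, rising_succ, Nat.descFactorial_succ, mul_comm (t - m),
        Nat.cast_mul, Nat.cast_sub ht, mul_div_mul_comm]
      congr 1
      field_simp
      ring
  | succ k ih =>
    have h2 := ih.mul (tendsto_inv_atTop_zero.comp (hlin ((m + k : ℕ) : ℝ)))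
    rw [mul_zero] at h2
    simp only [Nat.add_eq_zero_iff, one_ne_zero, and_false, if_false]
    refine h2.congr fun t => ?_
    rw [← add_assoc m, rising_succ, Function.comp_apply, div_mul_eq_div_div, div_eq_mul_inv _ (_ + _)]

open Filter Topology in
theorem tendsto_mixed_moment_weight {a : ℝ} (ha : 0 < a) {m n : ℕ} (hmn : m ≤ n) :
    Tendsto (fun K : ℕ => rising a (K - n) * rising a n *
      (((K - n).choose m : ℝ) * (n.choose m : ℝ) * ((m.factorial : ℝ) / rising a m)) / rising a K)
      atTop (𝓝 (if m = n then 1 else 0)) := by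
  obtain ⟨k, rfl⟩ := Nat.exists_eq_add_of_le hmn
  -- Substituting `K = t + n` removes the truncated subtraction; the weight becomes a constant times
  -- a quotient of degree `m` over degree `n`.
  rw [← tendsto_add_atTop_iff_nat (m + k)]
  have h := (tendsto_descFactorial_div_rising a m k).mul_const
    (rising a (m + k) * ((m + k).choose m : ℝ) / rising a m)
  have e : (if k = 0 then (1 : ℝ) else 0) * (rising a (m + k) * ((m + k).choose m : ℝ) / rising a m) =
      if m = m + k then 1 else 0 := by
    by_cases hk : k = 0
    · subst hk
      simp [(rising_pos ha m).ne']
    · simp [hk]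
  rw [e] at h
  refine h.congr fun t => ?_
  have h1 := (rising_pos ha t).ne'
  have h2 := (rising_pos ha m).ne'
  have h3 := (rising_pos (show 0 < a + t by positivity) (m + k)).ne'
  rw [Nat.add_sub_cancel, rising_add a t, Nat.descFactorial_eq_factorial_mul_choose]
  push_cast
  field_simp

/-- The case `b = ∞` of the correlation formula, where `Y = X` and `z = 1`. -/
theorem integral_scaledLaguerre_sq {a : ℝ} (ha : 0 < a) (n : ℕ) :
    ∫ x, scaledLaguerre a n x ^ 2 ∂gammaMeasure a 1 = (n.factorial : ℝ) / rising a n := by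
  have h := integral_scaledLaguerre_oneDimAlgorithm ha ⊤ n n
  have hm : Measurable (scaledLaguerre a n) := by unfold scaledLaguerre; fun_prop
  rw [oneDimAlgorithm, if_pos rfl, integral_map (by fun_prop)
    (Measurable.aestronglyMeasurable (by fun_prop))] at h
  simpa [ratio, sq] using h

/-- With `R` the scaled polynomial, `R(X) R(Y) ≤ (R(X)^2 + R(Y)^2) / 2`, and both squares have the
same mean because the marginals agree. -/
theorem HasCorrelations.le_one {μ : Measure ((Fin d → ℝ) × (Fin d → ℝ))}
    {ρ : (Fin d → ℕ) → ℝ} (h : HasCorrelations α μ ρ) (hμ : HasGammaMarginals α μ)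
    (hα : ∀ i, 0 < α i) (n : Fin d → ℕ) : ρ n ≤ 1 := by
  have (i : Fin d) := isProbabilityMeasure_gammaMeasure (hα i) one_pos
  rw [hasCorrelations_iff hα] at h
  have hnn := h n n
  rw [if_pos rfl] at hnn
  have hpos : 0 < scaledNormSq α n :=
    Finset.prod_pos fun i _ => div_pos (by positivity) (rising_pos (hα i) _)
  set R : (Fin d → ℝ) → ℝ := fun x => ∏ i, scaledLaguerre (α i) (n i) (x i)
  have hR : MemLp R 2 (productGamma α) :=
    memLp_prod_productGamma hα fun i => memLp_scaledLaguerre (hα i) (n i)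
  have hsq : ∫ x, R x ^ 2 ∂productGamma α = scaledNormSq α n := by
    simp_rw [R, ← Finset.prod_pow]
    refine (integral_fintype_prod_eq_prod
      (fun i x => scaledLaguerre (α i) (n i) x ^ 2)).trans ?_
    exact Finset.prod_congr rfl fun i _ => integral_scaledLaguerre_sq (hα i) _
  have i1 : Integrable (fun p => R p.1 ^ 2) μ :=
    hμ.fst.integrable_comp_of_integrable hR.integrable_sq
  have i2 : Integrable (fun p => R p.2 ^ 2) μ :=
    hμ.snd.integrable_comp_of_integrable hR.integrable_sq
  have e1 : ∫ p, R p.1 ^ 2 ∂μ = scaledNormSq α n := by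
    rw [← hsq, ← hμ.fst.map_eq, integral_map measurable_fst.aemeasurable]
    rw [hμ.fst.map_eq]; exact hR.integrable_sq.1
  have e2 : ∫ p, R p.2 ^ 2 ∂μ = scaledNormSq α n := by
    rw [← hsq, ← hμ.snd.map_eq, integral_map measurable_snd.aemeasurable]
    rw [hμ.snd.map_eq]; exact hR.integrable_sq.1
  have hle : ∫ p, R p.1 * R p.2 ∂μ ≤ ∫ p, (R p.1 ^ 2 + R p.2 ^ 2) / 2 ∂μ := by
    refine integral_mono ?_ ((i1.add i2).div_const 2) fun p => ?_
    · exact hμ.integrable hα (fun i => memLp_scaledLaguerre (hα i) (n i))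
        (fun i => memLp_scaledLaguerre (hα i) (n i))
    · dsimp only
      nlinarith [sq_nonneg (R p.1 - R p.2)]
  rw [integral_div, integral_add i1 i2] at hle
  rw [e1, e2, hnn] at hle
  nlinarith

/-- Mixed moments of the ratios `Y / X` under the law weighted by a high power of `X`. -/
noncomputable def ratioMoment (α : Fin d → ℝ) (μ : Measure ((Fin d → ℝ) × (Fin d → ℝ))) (K : ℕ)
    (n : Fin d → ℕ) : ℝ :=
  (∫ p, (∏ i, p.1 i ^ (K - n i)) * (∏ i, p.2 i ^ n i) ∂μ) / ∏ i, rising (α i) K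

open Filter Topology in
theorem HasCorrelations.tendsto_ratioMoment {μ : Measure ((Fin d → ℝ) × (Fin d → ℝ))}
    {ρ : (Fin d → ℕ) → ℝ} (h : HasCorrelations α μ ρ) (hμ : HasGammaMarginals α μ)
    (hα : ∀ i, 0 < α i) (n : Fin d → ℕ) :
    Tendsto (fun K => ratioMoment α μ K n) atTop (𝓝 (ρ n)) := by
  simp_rw [ratioMoment, h.integral_pow hμ hα (fun i => _ - n i) n, Finset.sum_div,
    mul_div_right_comm, ← Finset.prod_div_distrib]
  have h1 : Tendsto (fun K => ∑ m ∈ Fintype.piFinset fun i => Finset.range (n i + 1),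
      (∏ i, rising (α i) (K - n i) * rising (α i) (n i) *
          (((K - n i).choose (m i) : ℝ) * ((n i).choose (m i) : ℝ) *
            (((m i).factorial : ℝ) / rising (α i) (m i))) / rising (α i) K) * ρ m) atTop
      (𝓝 (∑ m ∈ Fintype.piFinset fun i => Finset.range (n i + 1),
        (∏ i, if m i = n i then 1 else 0) * ρ m)) := by
    refine tendsto_finsetSum _ fun m hm => Tendsto.mul_const _ (tendsto_finsetProd _ fun i _ => ?_)
    have hmi := Fintype.mem_piFinset.1 hm i
    exact tendsto_mixed_moment_weight (hα i) (by simpa [Nat.lt_succ_iff] using hmi)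
  convert! h1 using 2
  rw [Finset.sum_eq_single n]
  · simp
  · intro m _ hm
    obtain ⟨i, hi⟩ := Function.ne_iff.1 hm
    rw [Finset.prod_eq_zero (Finset.mem_univ i) (if_neg hi), zero_mul]
  · intro hn
    simp at hn

/-! ### Clamped ratios and moments on the unit cube -/

/-- The vector of ratios `Y / X`, clamped to the unit interval. -/
noncomputable def clampedRatio (p : (Fin d → ℝ) × (Fin d → ℝ)) (i : Fin d) : unitInterval :=
  Set.projIcc 0 1 zero_le_one (p.2 i / p.1 i)

theorem measurable_clampedRatio : Measurable (clampedRatio (d := d)) :=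
  measurable_pi_lambda _ fun i => continuous_projIcc.measurable.comp
    (f := fun p : (Fin d → ℝ) × (Fin d → ℝ) => p.2 i / p.1 i) (by fun_prop)

theorem coe_projIcc_of_nonneg {w : ℝ} (hw : 0 ≤ w) :
    (Set.projIcc (0 : ℝ) 1 zero_le_one w : ℝ) = min 1 w := by
  rw [Set.coe_projIcc, max_eq_right (le_min zero_le_one hw)]

theorem prod_min_one_pow_le {w : Fin d → ℝ} (hw : ∀ i, 0 ≤ w i) (n : Fin d → ℕ) :
    ∏ i, min 1 (w i) ^ n i ≤ ∏ i, w i ^ n i :=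
  Finset.prod_le_prod (fun i _ => pow_nonneg (le_min zero_le_one (hw i)) _) fun i _ =>
    pow_le_pow_left₀ (le_min zero_le_one (hw i)) (min_le_right _ _) _

/-- If all `w i ≤ c`, then `w i ≤ c * min 1 (w i)`. Otherwise some `(w i / c)^N ≥ 1`, and the
corresponding summand alone dominates, as in Markov's inequality. -/
theorem prod_pow_le_truncated {w : Fin d → ℝ} (hw : ∀ i, 0 ≤ w i) (n : Fin d → ℕ) {c : ℝ}
    (hc : 1 < c) (N : ℕ) :
    ∏ i, w i ^ n i ≤ c ^ (∑ i, n i) * ∏ i, min 1 (w i) ^ n i +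
      ∑ i, (c ^ N)⁻¹ * ∏ l, w l ^ (n + Pi.single i N : Fin d → ℕ) l := by
  have hc0 : 0 < c := by linarith
  have hnn (n : Fin d → ℕ) : 0 ≤ ∏ i, w i ^ n i := Finset.prod_nonneg fun i _ => pow_nonneg (hw i) _
  have hmin : 0 ≤ ∏ i, min 1 (w i) ^ n i :=
    Finset.prod_nonneg fun i _ => pow_nonneg (le_min zero_le_one (hw i)) _
  have hsum (i : Fin d) : 0 ≤ (c ^ N)⁻¹ * ∏ l, w l ^ (n + Pi.single i N : Fin d → ℕ) l :=
    mul_nonneg (by positivity) (hnn _)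
  by_cases h : ∀ i, w i ≤ c
  · refine le_add_of_le_of_nonneg ?_ (Finset.sum_nonneg fun i _ => hsum i)
    rw [← Finset.prod_pow_eq_pow_sum, ← Finset.prod_mul_distrib]
    refine Finset.prod_le_prod (fun i _ => pow_nonneg (hw i) _) fun i _ => ?_
    rw [← mul_pow]
    refine pow_le_pow_left₀ (hw i) ?_ _
    rcases le_total 1 (w i) with h1 | h1
    · rw [min_eq_left h1, mul_one]; exact h i
    · rw [min_eq_right h1]; nlinarith [hw i]
  · push Not at h
    obtain ⟨i, hi⟩ := h
    refine le_add_of_nonneg_of_le (by positivity) ?_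
    refine le_trans ?_ (Finset.single_le_sum (fun i _ => hsum i) (Finset.mem_univ i))
    have e : ∏ l, w l ^ (n + Pi.single i N : Fin d → ℕ) l = (∏ l, w l ^ n l) * w i ^ N := by
      simp_rw [Pi.add_apply, pow_add, Finset.prod_mul_distrib]
      congr 1
      rw [Finset.prod_eq_single i (fun j _ hj => by simp [hj]) (by simp), Pi.single_eq_same]
    rw [e, mul_left_comm]
    refine le_mul_of_one_le_right (hnn n) ?_
    rw [← div_eq_inv_mul, one_le_div (by positivity)]
    exact pow_le_pow_left₀ hc0.le hi.le N

/-- The weight proportional to the `K`-th power of the first coordinate vector. -/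
noncomputable def powerWeight (α : Fin d → ℝ) (K : ℕ) (p : (Fin d → ℝ) × (Fin d → ℝ)) : ℝ≥0 :=
  ((∏ i, p.1 i ^ K) / ∏ i, rising (α i) K).toNNReal

theorem measurable_powerWeight (K : ℕ) : Measurable (powerWeight α K) := by
  unfold powerWeight; fun_prop

/-- The law of the clamped ratios `Y / X` under the law weighted by a power of `X`. -/
noncomputable def clampedLaw (α : Fin d → ℝ) (μ : Measure ((Fin d → ℝ) × (Fin d → ℝ))) (K : ℕ) :
    Measure (Fin d → unitInterval) :=
  (μ.withDensity fun p => powerWeight α K p).map clampedRatio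

theorem HasGammaMarginals.ae_pos {μ : Measure ((Fin d → ℝ) × (Fin d → ℝ))}
    (hμ : HasGammaMarginals α μ) (hα : ∀ i, 0 < α i) :
    ∀ᵐ p ∂μ, (∀ i, 0 < p.1 i) ∧ ∀ i, 0 < p.2 i := by
  have (i : Fin d) := isProbabilityMeasure_gammaMeasure (hα i) one_pos
  have h : ∀ᵐ x ∂productGamma α, ∀ i, 0 < x i := by
    rw [ae_all_iff]
    exact fun i => (measurePreserving_eval (fun i => gammaMeasure (α i) 1)
      i).quasiMeasurePreserving.ae (ae_pos_gammaMeasure (α i) 1)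
  exact (hμ.fst.quasiMeasurePreserving.ae h).and (hμ.snd.quasiMeasurePreserving.ae h)

theorem integral_clampedLaw (μ : Measure ((Fin d → ℝ) × (Fin d → ℝ))) (K : ℕ) (n : Fin d → ℕ) :
    ∫ z, ∏ i, (z i : ℝ) ^ n i ∂clampedLaw α μ K =
      ∫ p, powerWeight α K p * ∏ i, (clampedRatio p i : ℝ) ^ n i ∂μ := by
  rw [clampedLaw, integral_map measurable_clampedRatio.aemeasurable
    (Measurable.aestronglyMeasurable (by fun_prop)),
    integral_withDensity_eq_integral_smul (measurable_powerWeight K)]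
  rfl

theorem integral_pow_gammaMeasure {a : ℝ} (ha : 0 < a) (k : ℕ) :
    ∫ x, x ^ k ∂gammaMeasure a 1 = rising a k := by
  have h := lintegral_pow_gammaMeasure ha one_pos k
  rw [one_pow, div_one] at h
  exact (integrable_and_integral_eq_of_lintegral (by fun_prop)
    ((ae_pos_gammaMeasure a 1).mono fun x hx => pow_nonneg hx.le k) (rising_pos ha k).le h).2

theorem coe_powerWeight (hα : ∀ i, 0 < α i) (K : ℕ) {p : (Fin d → ℝ) × (Fin d → ℝ)}
    (hp : ∀ i, 0 < p.1 i) :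
    (powerWeight α K p : ℝ) = (∏ i, p.1 i ^ K) / ∏ i, rising (α i) K :=
  Real.coe_toNNReal _ (div_nonneg (Finset.prod_nonneg fun i _ => (pow_pos (hp i) K).le)
    (Finset.prod_nonneg fun i _ => (rising_pos (hα i) K).le))

theorem ratioMoment_integrand (hα : ∀ i, 0 < α i) {μ : Measure ((Fin d → ℝ) × (Fin d → ℝ))}
    (hμ : HasGammaMarginals α μ) {K : ℕ} {n : Fin d → ℕ} (hn : ∀ i, n i ≤ K) :
    (fun p : (Fin d → ℝ) × (Fin d → ℝ) =>
      ((∏ i, p.1 i ^ (K - n i)) * (∏ i, p.2 i ^ n i)) / ∏ i, rising (α i) K) =ᵐ[μ]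
    fun p => (powerWeight α K p : ℝ) * ∏ i, (p.2 i / p.1 i) ^ n i := by
  filter_upwards [hμ.ae_pos hα] with p hp
  rw [coe_powerWeight hα K hp.1, div_mul_eq_mul_div, ← Finset.prod_mul_distrib,
    ← Finset.prod_mul_distrib]
  congr 1
  refine Finset.prod_congr rfl fun i _ => ?_
  have hx := (hp.1 i).ne'
  obtain ⟨k, hk⟩ := Nat.exists_eq_add_of_le (hn i)
  rw [hk, Nat.add_sub_cancel_left, div_pow, pow_add]
  field_simp

theorem ratioMoment_eq (hα : ∀ i, 0 < α i) {μ : Measure ((Fin d → ℝ) × (Fin d → ℝ))}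
    (hμ : HasGammaMarginals α μ) {K : ℕ} {n : Fin d → ℕ} (hn : ∀ i, n i ≤ K) :
    ratioMoment α μ K n = ∫ p, (powerWeight α K p : ℝ) * ∏ i, (p.2 i / p.1 i) ^ n i ∂μ := by
  rw [ratioMoment, ← integral_div]
  exact integral_congr_ae (ratioMoment_integrand hα hμ hn)

theorem integrable_ratioMoment (hα : ∀ i, 0 < α i) {μ : Measure ((Fin d → ℝ) × (Fin d → ℝ))}
    (hμ : HasGammaMarginals α μ) {K : ℕ} {n : Fin d → ℕ} (hn : ∀ i, n i ≤ K) :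
    Integrable (fun p => (powerWeight α K p : ℝ) * ∏ i, (p.2 i / p.1 i) ^ n i) μ :=
  ((hμ.integrable hα (f := fun i x => x ^ (K - n i)) (g := fun i x => x ^ n i)
    (fun i => memLp_pow_gammaMeasure (hα i) _)
    (fun i => memLp_pow_gammaMeasure (hα i) _)).div_const _).congr
      (ratioMoment_integrand hα hμ hn)

theorem integral_powerWeight (hα : ∀ i, 0 < α i) {μ : Measure ((Fin d → ℝ) × (Fin d → ℝ))}
    (hμ : HasGammaMarginals α μ) (K : ℕ) :
    Integrable (fun p => (powerWeight α K p : ℝ)) μ ∧ ∫ p, (powerWeight α K p : ℝ) ∂μ = 1 := by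
  have (i : Fin d) := isProbabilityMeasure_gammaMeasure (hα i) one_pos
  have h0 : ∀ i : Fin d, (0 : Fin d → ℕ) i ≤ K := fun i => Nat.zero_le _
  have h1 := integrable_ratioMoment hα hμ h0
  have h2 := ratioMoment_eq hα hμ h0
  simp only [Pi.zero_apply, pow_zero, Finset.prod_const_one, mul_one] at h1 h2
  refine ⟨h1, ?_⟩
  have h3 : ∫ p, ∏ i, p.1 i ^ K ∂μ = ∏ i, rising (α i) K := by
    calc ∫ p, ∏ i, p.1 i ^ K ∂μ = ∫ x, ∏ i, x i ^ K ∂productGamma α := by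
          rw [← hμ.fst.map_eq, integral_map measurable_fst.aemeasurable
            (Measurable.aestronglyMeasurable (by fun_prop))]
      _ = ∏ i, ∫ x, x ^ K ∂gammaMeasure (α i) 1 :=
          integral_fintype_prod_eq_prod fun i x => x ^ K
      _ = _ := Finset.prod_congr rfl fun i _ => integral_pow_gammaMeasure (hα i) K
  rw [← h2, ratioMoment]
  simp only [Pi.zero_apply, Nat.sub_zero, pow_zero, Finset.prod_const_one, mul_one, h3]
  exact div_self (Finset.prod_ne_zero_iff.2 fun i _ => (rising_pos (hα i) K).ne')

theorem isProbabilityMeasure_clampedLaw (hα : ∀ i, 0 < α i)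
    {μ : Measure ((Fin d → ℝ) × (Fin d → ℝ))} (hμ : HasGammaMarginals α μ) (K : ℕ) :
    IsProbabilityMeasure (clampedLaw α μ K) := by
  have : IsProbabilityMeasure (μ.withDensity fun p => powerWeight α K p) := by
    refine ⟨?_⟩
    obtain ⟨h1, h2⟩ := integral_powerWeight hα hμ K
    rw [withDensity_apply _ MeasurableSet.univ, Measure.restrict_univ]
    have h3 := ofReal_integral_eq_lintegral_ofReal h1 (Filter.Eventually.of_forall fun p =>
      (powerWeight α K p).coe_nonneg)
    simpa [h2] using h3.symm
  exact Measure.isProbabilityMeasure_map measurable_clampedRatio.aemeasurable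

theorem clampedRatio_apply {p : (Fin d → ℝ) × (Fin d → ℝ)} (h1 : ∀ i, 0 < p.1 i)
    (h2 : ∀ i, 0 < p.2 i) (i : Fin d) : (clampedRatio p i : ℝ) = min 1 (p.2 i / p.1 i) :=
  coe_projIcc_of_nonneg (div_pos (h2 i) (h1 i)).le

theorem integrable_powerWeight_mul_clampedRatio (hα : ∀ i, 0 < α i)
    {μ : Measure ((Fin d → ℝ) × (Fin d → ℝ))} (hμ : HasGammaMarginals α μ) (K : ℕ)
    (n : Fin d → ℕ) :
    Integrable (fun p => (powerWeight α K p : ℝ) * ∏ i, (clampedRatio p i : ℝ) ^ n i) μ := by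
  have hm : Measurable fun p : (Fin d → ℝ) × (Fin d → ℝ) =>
      ∏ i, (clampedRatio p i : ℝ) ^ n i :=
    Finset.measurable_prod _ fun i _ => ((measurable_subtype_coe.comp
      ((measurable_pi_apply i).comp measurable_clampedRatio)).pow_const _)
  refine (integral_powerWeight hα hμ K).1.mono'
    ((measurable_powerWeight K).coe_nnreal_real.mul hm).aestronglyMeasurable
    (Filter.Eventually.of_forall fun p => ?_)
  have h1 : 0 ≤ ∏ i, (clampedRatio p i : ℝ) ^ n i :=
    Finset.prod_nonneg fun i _ => pow_nonneg (clampedRatio p i).2.1 _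
  have h2 : ∏ i, (clampedRatio p i : ℝ) ^ n i ≤ 1 :=
    Finset.prod_le_one (fun i _ => pow_nonneg (clampedRatio p i).2.1 _)
      fun i _ => pow_le_one₀ (clampedRatio p i).2.1 (clampedRatio p i).2.2
  rw [Real.norm_of_nonneg (mul_nonneg (NNReal.coe_nonneg _) h1)]
  exact mul_le_of_le_one_right (NNReal.coe_nonneg _) h2

theorem integral_clampedLaw_le (hα : ∀ i, 0 < α i)
    {μ : Measure ((Fin d → ℝ) × (Fin d → ℝ))} (hμ : HasGammaMarginals α μ) {K : ℕ}
    {n : Fin d → ℕ} (hn : ∀ i, n i ≤ K) :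
    ∫ z, ∏ i, (z i : ℝ) ^ n i ∂clampedLaw α μ K ≤ ratioMoment α μ K n := by
  rw [integral_clampedLaw, ratioMoment_eq hα hμ hn]
  refine integral_mono_ae (integrable_powerWeight_mul_clampedRatio hα hμ K n)
    (integrable_ratioMoment hα hμ hn) ?_
  filter_upwards [hμ.ae_pos hα] with p hp
  simp_rw [clampedRatio_apply hp.1 hp.2]
  exact mul_le_mul_of_nonneg_left
    (prod_min_one_pow_le (fun i => (div_pos (hp.2 i) (hp.1 i)).le) n) (NNReal.coe_nonneg _)

/-- Integrating `prod_pow_le_truncated` against the weight shows that the clamping error is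
controlled by ratio moments of higher order, damped by `c^N`. -/
theorem ratioMoment_le (hα : ∀ i, 0 < α i)
    {μ : Measure ((Fin d → ℝ) × (Fin d → ℝ))} (hμ : HasGammaMarginals α μ) {K N : ℕ}
    {n : Fin d → ℕ} (hn : ∀ i, n i + N ≤ K) {c : ℝ} (hc : 1 < c) :
    ratioMoment α μ K n ≤ c ^ (∑ i, n i) * ∫ z, ∏ i, (z i : ℝ) ^ n i ∂clampedLaw α μ K +
      ∑ i, (c ^ N)⁻¹ * ratioMoment α μ K (n + Pi.single i N) := by
  have hn0 (i : Fin d) : n i ≤ K := (Nat.le_add_right _ _).trans (hn i)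
  have hn1 (j i : Fin d) : (n + Pi.single j N : Fin d → ℕ) i ≤ K := by
    rcases eq_or_ne i j with h | h
    · subst h; simpa using hn i
    · simpa [h] using hn0 i
  have hI (j : Fin d) := (integrable_ratioMoment hα hμ (hn1 j)).const_mul (c ^ N)⁻¹
  have hJ := (integrable_powerWeight_mul_clampedRatio hα hμ K n).const_mul (c ^ ∑ i, n i)
  simp_rw [integral_clampedLaw, ratioMoment_eq hα hμ hn0, fun j => ratioMoment_eq hα hμ (hn1 j)]
  simp_rw [← integral_const_mul]
  rw [← integral_finsetSum _ fun j _ => hI j, ← integral_add hJ (integrable_finsetSum _ fun j _ => hI j)]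
  refine integral_mono_ae (integrable_ratioMoment hα hμ hn0)
    (hJ.add (integrable_finsetSum _ fun j _ => hI j)) ?_
  filter_upwards [hμ.ae_pos hα] with p hp
  simp_rw [clampedRatio_apply hp.1 hp.2]
  have h := mul_le_mul_of_nonneg_left (prod_pow_le_truncated
    (fun i => (div_pos (hp.2 i) (hp.1 i)).le) n hc N) (powerWeight α K p).coe_nonneg
  refine h.trans_eq ?_
  rw [mul_add, Finset.mul_sum]
  congr 1
  · ring
  · exact Finset.sum_congr rfl fun i _ => by ring

open Filter Topology in
/-- A canonical correlation sequence is a moment sequence on the unit cube. -/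
theorem HasCorrelations.exists_unitInterval_moments {μ : Measure ((Fin d → ℝ) × (Fin d → ℝ))}
    {ρ : (Fin d → ℕ) → ℝ} (h : HasCorrelations α μ ρ) (hμ : HasGammaMarginals α μ)
    (hα : ∀ i, 0 < α i) :
    ∃ ν : Measure (Fin d → unitInterval), IsProbabilityMeasure ν ∧
      ∀ n, ρ n = ∫ z, ∏ i, (z i : ℝ) ^ n i ∂ν := by
  let u : ℕ → ProbabilityMeasure (Fin d → unitInterval) := fun K =>
    ⟨clampedLaw α μ K, isProbabilityMeasure_clampedLaw hα hμ K⟩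
  -- A free ultrafilter replaces the choice of a convergent subsequence; the probability measures on
  -- the cube form a compact space.
  let U : Ultrafilter ℕ := hyperfilter ℕ
  have hU : (U : Filter ℕ) ≤ atTop := Nat.hyperfilter_le_atTop
  obtain ⟨ν, -, hν⟩ := (isCompact_univ (X := ProbabilityMeasure (Fin d → unitInterval))
    ).ultrafilter_le_nhds (U.map u) (by simp)
  refine ⟨ν, inferInstance, fun n => ?_⟩
  have hlim : Tendsto (fun K => ∫ z, ∏ i, (z i : ℝ) ^ n i ∂clampedLaw α μ K) U
      (𝓝 (∫ z, ∏ i, (z i : ℝ) ^ n i ∂(ν : Measure (Fin d → unitInterval)))) := by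
    have hν' : Tendsto u U (𝓝 ν) := hν
    exact ProbabilityMeasure.tendsto_iff_forall_integral_tendsto.1 hν'
      (BoundedContinuousFunction.mkOfCompact ⟨fun z => ∏ i, (z i : ℝ) ^ n i, by fun_prop⟩)
  generalize ∫ z, ∏ i, (z i : ℝ) ^ n i ∂(ν : Measure (Fin d → unitInterval)) = M at hlim ⊢
  have hev (N : ℕ) : ∀ᶠ K in (U : Filter ℕ), ∀ i, n i + N ≤ K :=
    hU (eventually_all.2 fun i => eventually_ge_atTop _)
  have hρ (n : Fin d → ℕ) : Tendsto (fun K => ratioMoment α μ K n) U (𝓝 (ρ n)) :=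
    (h.tendsto_ratioMoment hμ hα n).mono_left hU
  have hle : M ≤ ρ n := le_of_tendsto_of_tendsto hlim (hρ n)
    ((hev 0).mono fun K hK => integral_clampedLaw_le hα hμ hK)
  -- The limit in `K` comes first. The tail moments tend to values of `ρ`, each at most one, so the
  -- error is at most `d / c^N`; then `N → ∞`, and finally `c` decreases to one.
  have hge (c : ℝ) (hc : 1 < c) (N : ℕ) : ρ n ≤ c ^ (∑ i, n i) * M + d * (c ^ N)⁻¹ := by
    have hs : Tendsto (fun K => ∑ i, (c ^ N)⁻¹ * ratioMoment α μ K (n + Pi.single i N)) U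
        (𝓝 (∑ i, (c ^ N)⁻¹ * ρ (n + Pi.single i N))) :=
      tendsto_finsetSum _ fun i _ => (hρ _).const_mul _
    have hc' : Tendsto (fun K => c ^ (∑ i, n i) * ∫ z, ∏ i, (z i : ℝ) ^ n i ∂clampedLaw α μ K) U
        (𝓝 (c ^ (∑ i, n i) * M)) := hlim.const_mul _
    have h1 : ρ n ≤ c ^ (∑ i, n i) * M + ∑ i, (c ^ N)⁻¹ * ρ (n + Pi.single i N) := by
      refine le_of_tendsto_of_tendsto (hρ n) (hc'.add hs) ?_
      filter_upwards [hev N] with K hK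
      exact ratioMoment_le hα hμ hK hc
    refine h1.trans (add_le_add_right ?_ _)
    calc ∑ i, (c ^ N)⁻¹ * ρ (n + Pi.single i N) ≤ ∑ i : Fin d, (c ^ N)⁻¹ :=
          Finset.sum_le_sum fun i _ => mul_le_of_le_one_right
            (inv_nonneg.2 (pow_nonneg (by linarith) N)) (h.le_one hμ hα _)
      _ = d * (c ^ N)⁻¹ := by simp
  have hge' (c : ℝ) (hc : 1 < c) : ρ n ≤ c ^ (∑ i, n i) * M := by
    have h1 : Tendsto (fun N : ℕ => c ^ (∑ i, n i) * M + d * (c ^ N)⁻¹) atTop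
        (𝓝 (c ^ (∑ i, n i) * M + d * 0)) :=
      tendsto_const_nhds.add (tendsto_const_nhds.mul
        (tendsto_inv_atTop_zero.comp (tendsto_pow_atTop_atTop_of_one_lt hc)))
    simpa using ge_of_tendsto' h1 (hge c hc)
  refine le_antisymm ?_ hle
  have h2 : Tendsto (fun c : ℝ => c ^ (∑ i, n i) * M) (𝓝[>] 1) (𝓝 (1 ^ (∑ i, n i) * M)) :=
    ((Continuous.tendsto (by fun_prop) 1).mono_left nhdsWithin_le_nhds)
  rw [one_pow, one_mul] at h2
  exact ge_of_tendsto h2 (eventually_mem_nhdsWithin.mono fun c hc => hge' c hc)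

/-! ### From the unit cube to the parameters of the algorithm -/

theorem ratio_ofReal_div {z : ℝ} (h0 : 0 ≤ z) (h1 : z ≤ 1) :
    ratio (ENNReal.ofReal z / ENNReal.ofReal (1 - z)) = z := by
  rcases h1.eq_or_lt with h | h
  -- At `z = 1` the quotient `1 / 0` is `∞` in `ℝ≥0∞`, where `ratio` is one by definition.
  · subst h
    simp [ratio]
  · have hz : 0 < 1 - z := by linarith
    rw [← ENNReal.ofReal_div_of_pos hz, ratio, if_neg ENNReal.ofReal_ne_top,
      ENNReal.toReal_ofReal (by positivity)]
    field_simp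
    ring

theorem HasCorrelations.exists_moments {μ : Measure ((Fin d → ℝ) × (Fin d → ℝ))}
    {ρ : (Fin d → ℕ) → ℝ} (h : HasCorrelations α μ ρ) (hμ : HasGammaMarginals α μ)
    (hα : ∀ i, 0 < α i) :
    ∃ Pstar : Measure (Fin d → ℝ≥0∞), IsProbabilityMeasure Pstar ∧
      ρ = fun n => ∫ b, ∏ i, ratio (b i) ^ n i ∂Pstar := by
  obtain ⟨ν, hν, hρ⟩ := h.exists_unitInterval_moments hμ hα
  have hm : Measurable fun (z : Fin d → unitInterval) (i : Fin d) =>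
      ENNReal.ofReal (z i) / ENNReal.ofReal (1 - z i) := by fun_prop
  refine ⟨ν.map _, Measure.isProbabilityMeasure_map hm.aemeasurable, funext fun n => ?_⟩
  have hr : Measurable fun b : Fin d → ℝ≥0∞ => ∏ i, ratio (b i) ^ n i :=
    Finset.measurable_prod _ fun i _ => (measurable_ratio.comp (measurable_pi_apply i)).pow_const _
  rw [integral_map hm.aemeasurable hr.aestronglyMeasurable, hρ]
  simp_rw [fun z : unitInterval => ratio_ofReal_div z.2.1 z.2.2]

theorem isCanonicalCorrelationSequence_iff {Ω : Type*} [MeasurableSpace Ω] {P : Measure Ω}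
    {X Y : Ω → Fin d → ℝ} (hX : AEMeasurable X P) (hY : AEMeasurable Y P)
    {ρ : (Fin d → ℕ) → ℝ} :
    IsCanonicalCorrelationSequence P α X Y ρ ↔
      HasCorrelations α (P.map fun ω => (X ω, Y ω)) ρ := by
  have hm (n : Fin d → ℕ) : Measurable (productLaguerre α n) := by
    unfold productLaguerre monicLaguerre laguerre; fun_prop
  refine forall₂_congr fun n m => ?_
  have h : Measurable fun p : (Fin d → ℝ) × (Fin d → ℝ) =>
      productLaguerre α n p.1 * productLaguerre α m p.2 :=
    ((hm n).comp measurable_fst).mul ((hm m).comp measurable_snd)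
  rw [integral_map (hX.prodMk hY) h.aestronglyMeasurable]

end GammaCC

/-! ### The characterization -/

theorem mainTheorem5 {d : ℕ} (α : Fin d → ℝ) (hα : ∀ i, 0 < α i)
    {Ω : Type*} [MeasurableSpace Ω] (P : Measure Ω) [IsProbabilityMeasure P]
    (X Y : Ω → Fin d → ℝ)
    (hX : HasLaw X (GammaCC.productGamma α) P) (hY : HasLaw Y (GammaCC.productGamma α) P) :
    (GammaCC.HasCanonicalCorrelations P α X Y ↔
      ∃ Pstar : Measure (Fin d → ℝ≥0∞),
        IsProbabilityMeasure Pstar ∧ GammaCC.GeneratedBy P α X Y Pstar) ∧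
    (∀ Pstar : Measure (Fin d → ℝ≥0∞), IsProbabilityMeasure Pstar →
      GammaCC.GeneratedBy P α X Y Pstar →
        ∀ ρ : (Fin d → ℕ) → ℝ, GammaCC.IsCanonicalCorrelationSequence P α X Y ρ ↔
          ∀ n : Fin d → ℕ, ρ n = ∫ b, ∏ i, GammaCC.ratio (b i) ^ n i ∂Pstar) ∧
    ((GammaCC.HasCanonicalCorrelations P α X Y ∧ ∀ i, P {ω | X ω i = Y ω i} = 0) ↔
      ∃ Pstar : Measure (Fin d → ℝ≥0∞),
        IsProbabilityMeasure Pstar ∧ (∀ᵐ b ∂Pstar, ∀ i, b i ≠ ⊤) ∧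
          GammaCC.GeneratedBy P α X Y Pstar) := by
  open GammaCC in
  have hXY : AEMeasurable (fun ω => (X ω, Y ω)) P := hX.aemeasurable.prodMk hY.aemeasurable
  have hμ : HasGammaMarginals α (P.map fun ω => (X ω, Y ω)) := by
    refine ⟨⟨measurable_fst, ?_⟩, ⟨measurable_snd, ?_⟩⟩
    · rw [AEMeasurable.map_map_of_aemeasurable measurable_fst.aemeasurable hXY, ← hX.map_eq]
      rfl
    · rw [AEMeasurable.map_map_of_aemeasurable measurable_snd.aemeasurable hXY, ← hY.map_eq]
      rfl
  have hcor (Pstar : Measure (Fin d → ℝ≥0∞)) [IsProbabilityMeasure Pstar]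
      (hg : GeneratedBy P α X Y Pstar) : IsCanonicalCorrelationSequence P α X Y
        fun n => ∫ b, ∏ i, ratio (b i) ^ n i ∂Pstar := by
    rw [isCanonicalCorrelationSequence_iff hX.aemeasurable hY.aemeasurable, hg.map_eq]
    exact hasCorrelations_mixtureAlgorithm hα Pstar
  have hex (hc : HasCanonicalCorrelations P α X Y) : ∃ Pstar : Measure (Fin d → ℝ≥0∞),
      IsProbabilityMeasure Pstar ∧ GeneratedBy P α X Y Pstar := by
    obtain ⟨ρ, hρ⟩ := hc
    rw [isCanonicalCorrelationSequence_iff hX.aemeasurable hY.aemeasurable] at hρ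
    obtain ⟨Pstar, hP, rfl⟩ := hρ.exists_moments hμ hα
    exact ⟨Pstar, hP, hXY, HasCorrelations.measure_eq hα hμ
      (hasGammaMarginals_mixtureAlgorithm hα Pstar) hρ (hasCorrelations_mixtureAlgorithm hα Pstar)⟩
  have hdiag (Pstar : Measure (Fin d → ℝ≥0∞)) (hg : GeneratedBy P α X Y Pstar) (i : Fin d) :
      P {ω | X ω i = Y ω i} = Pstar {b | b i = ⊤} := by
    have hs : MeasurableSet {p : (Fin d → ℝ) × (Fin d → ℝ) | p.1 i = p.2 i} :=
      measurableSet_eq_fun (by fun_prop) (by fun_prop)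
    rw [← mixtureAlgorithm_diagonal hα Pstar i, ← hg.map_eq, Measure.map_apply_of_aemeasurable hXY hs]
    rfl
  have htop (Pstar : Measure (Fin d → ℝ≥0∞)) :
      (∀ᵐ b ∂Pstar, ∀ i, b i ≠ ⊤) ↔ ∀ i, Pstar {b | b i = ⊤} = 0 := by
    rw [ae_all_iff]
    simp [ae_iff]
  refine ⟨⟨hex, ?_⟩, ?_, ⟨?_, ?_⟩⟩
  · rintro ⟨Pstar, hP, hg⟩
    exact ⟨_, hcor Pstar hg⟩
  · intro Pstar hP hg ρ
    have h0 := hcor Pstar hg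
    constructor
    -- A correlation sequence is unique: the diagonal case `n = m` already fixes it.
    · intro hρ n
      have h1 := hρ n n
      have h2 := h0 n n
      rw [if_pos rfl] at h1 h2
      rw [← h1, h2]
    · intro hρ
      rwa [funext hρ]
  · rintro ⟨hc, hd⟩
    obtain ⟨Pstar, hP, hg⟩ := hex hc
    exact ⟨Pstar, hP, (htop Pstar).2 fun i => by rw [← hdiag Pstar hg, hd], hg⟩
  · rintro ⟨Pstar, hP, ht, hg⟩
    exact ⟨⟨_, hcor Pstar hg⟩, fun i => by rw [hdiag Pstar hg, (htop Pstar).1 ht]⟩
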